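/- Let $d\in\mathbb N$, $\lambda>0$, $\delta>0$, and let $f:\mathbb R^d\to\mathbb R$ be a convex (hence continuous) function that has at least one minimizer and satisfies $\int_{\mathbb R^d} e^{-f(y)/\delta}\,dy<\infty$. Define the soft Moreau envelope and the zeroth-order proximal operator by $$f^{\lambda,\delta}(x)=-\delta\log \mathbb E_{y\sim\mathcal N(x,\lambda\delta I)}\big[e^{-f(y)/\delta}\big],\qquad \operatorname{zprox}^{\delta}_{\lambda,f}(x)=\frac{\mathbb E_{y\sim\mathcal N(x,\lambda\delta I)}\big[y\,e^{-f(y)/\delta}\big]}{\mathbb E_{y\sim\mathcal N(x,\lambda\delta I)}\big[e^{-f(y)/\delta}\big]}.$$ Let $X^\star=\operatorname{argmin} f$ and $X^\star_{\lambda,\delta}=\operatorname{argmin} f^{\lambda,\delta}$. For $\varepsilon\ge 0$ let $\partial_\varepsilon f(x)=\{g\in\mathbb R^d: f(y)\ge f(x)+\langle g,y-x\rangle-\varepsilon\ \text{for all } y\in\mathbb R^d\}$. Then $f^{\lambda,\delta}$ is differentiable, $X^\star_{\lambda,\delta}\neq\emptyset$, and for every $x\in\mathbb R^d$ $$\nabla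 f^{\lambda,\delta}(x)\in\partial_{d\delta}f\big(\operatorname{zprox}^{\delta}_{\lambda,f}(x)\big).$$ Moreover, let $x^0\in\mathbb R^d$ and $x^{k+1}=\operatorname{zprox}^{\delta}_{\lambda,f}(x^k)$ for all $k\ge 0$. Then: (i) for every $k\ge 1$, $$f(x^k)-\min f\le \|\nabla f^{\lambda,\delta}(x^{k-1})\|\operatorname{dist}(x^k,X^\star)+d\delta;$$ (ii) if $f$ is in addition $L$-smooth, i.e. $f$ is $C^1$ and $\|\nabla f(x)-\nabla f(y)\|\le L\|x-y\|$ for all $x,y$, then for every $k\ge 0$ $$\|\nabla f(x^k)\|\le(1+\lambda L)\|\nabla f^{\lambda,\delta}(x^k)\|+L\sqrt{d\lambda\delta}$$ and $$f(x^k)-\min f\le\Big((1+\lambda L)\|\nabla f^{\lambda,\delta}(x^k)\|+L\sqrt{d\lambda\delta}\Big)\operatorname{dist}(x^k,X^\star).$$ In these bounds, for every $k\ge 0$, $$\|\nabla f^{\lambda,\delta}(x^k)\|\le\frac{2\operatorname{dist}(x^0,X^\star_{\lambda,\delta})}{\lambda(k+1)}.$$ -/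

import Mathlib

open MeasureTheory ProbabilityTheory

noncomputable section

/-- The standing assumption on the objective `f : ℝᵈ → ℝ` at temperature `δ`: `f` is continuous,
has at least one minimizer, and `exp (-f / δ)` is Lebesgue integrable. -/
structure StandingAssumption {d : ℕ} (f : EuclideanSpace ℝ (Fin d) → ℝ) (δ : ℝ) : Prop where
  continuous : Continuous f
  exists_minimizer : ∃ x, ∀ y, f x ≤ f y
  integrable_exp : Integrable (fun y => Real.exp (-f y / δ)) volume

/-- The isotropic Gaussian law `𝒩(x, v I)` on `ℝᵈ`. -/
def isoGaussian {d : ℕ} (x : EuclideanSpace ℝ (Fin d)) (v : ℝ) :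
    Measure (EuclideanSpace ℝ (Fin d)) :=
  multivariateGaussian x (v • (1 : Matrix (Fin d) (Fin d) ℝ))

/-- The zeroth-order proximal operator:
`𝔼[y exp (-f y / δ)] / 𝔼[exp (-f y / δ)]` for `y ∼ 𝒩(x, lam δ I)`. -/
def zprox {d : ℕ} (f : EuclideanSpace ℝ (Fin d) → ℝ) (lam δ : ℝ)
    (x : EuclideanSpace ℝ (Fin d)) : EuclideanSpace ℝ (Fin d) :=
  (∫ y, Real.exp (-f y / δ) ∂(isoGaussian x (lam * δ)))⁻¹ •
    ∫ y, Real.exp (-f y / δ) • y ∂(isoGaussian x (lam * δ))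

/-- The soft Moreau envelope: `-δ log 𝔼[exp (-f y / δ)]` for `y ∼ 𝒩(x, lam δ I)`. -/
def softMoreau {d : ℕ} (f : EuclideanSpace ℝ (Fin d) → ℝ) (lam δ : ℝ)
    (x : EuclideanSpace ℝ (Fin d)) : ℝ :=
  -δ * Real.log (∫ y, Real.exp (-f y / δ) ∂(isoGaussian x (lam * δ)))

/-- The set of global minimizers of `g`. -/
def argminSet {d : ℕ} (g : EuclideanSpace ℝ (Fin d) → ℝ) : Set (EuclideanSpace ℝ (Fin d)) :=
  {x | ∀ y, g x ≤ g y}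

/-- The `ε`-subdifferential of `f` at `x`. -/
def epsSubdifferential {d : ℕ} (ε : ℝ) (f : EuclideanSpace ℝ (Fin d) → ℝ)
    (x : EuclideanSpace ℝ (Fin d)) : Set (EuclideanSpace ℝ (Fin d)) :=
  {g | ∀ y, f x + inner ℝ g (y - x) - ε ≤ f y}

/-- `f` is `L`-smooth: it is `C¹` with `L`-Lipschitz gradient. -/
def LSmooth {d : ℕ} (L : ℝ) (f : EuclideanSpace ℝ (Fin d) → ℝ) : Prop :=
  ContDiff ℝ 1 f ∧ ∀ x y, ‖gradient f x - gradient f y‖ ≤ L * ‖x - y‖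

/-- `x 0, x 1, …` is generated by the zeroth-order proximal point algorithm. -/
def IsZoppaSequence {d : ℕ} (f : EuclideanSpace ℝ (Fin d) → ℝ) (lam δ : ℝ)
    (x : ℕ → EuclideanSpace ℝ (Fin d)) : Prop :=
  ∀ k, x (k + 1) = zprox f lam δ (x k)

end

/-! Write `h` for the soft Moreau envelope, `p` for the zeroth-order prox of `x`, and `π` for the
Gibbs law at `x`, with density proportional to `exp (-f y / δ - ‖y - x‖² / (2 lam δ))`, so that `p`
is the mean of `π`. Up to a constant, `h` is `-δ` times the logarithm of the mass `Z` of this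
density. Its gradient is `lam⁻¹ • (x - p)`, so the algorithm is gradient descent on `h` with step
`lam`, and the rate is the one for convex `1 / lam`-smooth functions.

Convexity of `h` is the Prékopa–Leindler inequality, since the exponent is jointly concave in `(x,
y)`; only its midpoint form is needed. All other estimates on `h` come from one inequality,
`exp_integral_tilted_mul_le`, which is Jensen for `exp`. Recentring the Gaussian gives the quadratic
upper model of `h`; contracting the variable towards `z` gives the virial inequality
`integral_sub_add_integral_inner_le`; translating the variable compares the gradient of `h` with
that of `f`. No differentiation under the integral occurs.

The virial inequality is the source of `d * δ`. Splitting its inner product at the mean `p` and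
using `f p ≤ 𝔼 f` gives the approximate subgradient when the variance is dropped, and a variance at
most `d * lam * δ` when `z = p`. For `L`-smooth `f`, the gradients of `h` and `f` at `x` differ by
at most `L 𝔼‖y - x‖`, which the variance bound controls. -/

open scoped ENNReal

/-! ### Prékopa–Leindler inequality for midpoints. -/

/-- The one-dimensional Brunn–Minkowski inequality for midpoints. -/
theorem Real.volume_add_volume_le_two_mul_of_midpoints_subset {A B C : Set ℝ}
    (hA : MeasurableSet A) (hB : MeasurableSet B) (hC : MeasurableSet C)
    (hA0 : A.Nonempty) (hB0 : B.Nonempty)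
    (h : ∀ u ∈ A, ∀ v ∈ B, (2⁻¹ : ℝ) * (u + v) ∈ C) :
    volume A + volume B ≤ 2 * volume C := by
  obtain ⟨a, ha⟩ := hA0
  obtain ⟨b, hb⟩ := hB0
  set D : Set ℝ := (fun x => 2⁻¹ * x) ⁻¹' C with hD
  have hDm : MeasurableSet D := hC.preimage (by fun_prop)
  have hDv : volume D = 2 * volume C := by
    rw [hD, Real.volume_preimage_mul_left (by norm_num)]
    norm_num
  -- With `M = max K` and `m = min L`, the translates `K + m` and `M + L` both lie in `D` and meet
  -- at most in the null set `{M + m}`. Inserting `a` and `b` makes these extrema exist when `K` or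
  -- `L` is empty.
  have key : ∀ K L : Set ℝ, K ⊆ A → IsCompact K → L ⊆ B → IsCompact L →
      volume K + volume L ≤ volume D := by
    intro K L hKA hK hLB hL
    have hK' : IsCompact (insert a K) := hK.insert a
    have hL' : IsCompact (insert b L) := hL.insert b
    obtain ⟨M, hMK, hM⟩ := hK'.exists_isGreatest ⟨a, by simp⟩
    obtain ⟨m, hmL, hm⟩ := hL'.exists_isLeast ⟨b, by simp⟩
    have hKA' : insert a K ⊆ A := Set.insert_subset ha hKA
    have hLB' : insert b L ⊆ B := Set.insert_subset hb hLB
    have e1 : volume K ≤ volume (D ∩ Set.Iic (M + m)) := by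
      calc volume K = volume ((fun x => x + -m) ⁻¹' K) := (measure_preimage_add_right _ _ _).symm
        _ ≤ volume (D ∩ Set.Iic (M + m)) := measure_mono (fun x hx => ⟨by
            have := h _ (hKA hx) _ (hLB' hmL)
            simpa [hD] using this, by
            have := hM (Set.mem_insert_of_mem a hx)
            simp only [Set.mem_Iic]; linarith⟩)
    have e2 : volume L ≤ volume (D ∩ Set.Ici (M + m)) := by
      calc volume L = volume ((fun x => -M + x) ⁻¹' L) := (measure_preimage_add _ _ _).symm
        _ ≤ volume (D ∩ Set.Ici (M + m)) := measure_mono (fun x hx => ⟨by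
            have := h _ (hKA' hMK) _ (hLB hx)
            simpa [hD] using this, by
            have := hm (Set.mem_insert_of_mem b hx)
            simp only [Set.mem_Ici]; linarith⟩)
    have e3 : volume (D ∩ Set.Ici (M + m)) = volume (D ∩ Set.Ioi (M + m)) :=
      measure_congr ((ae_eq_refl D).inter Ioi_ae_eq_Ici.symm)
    calc volume K + volume L
        ≤ volume (D ∩ Set.Iic (M + m)) + volume (D ∩ Set.Ioi (M + m)) :=
          add_le_add e1 (e3 ▸ e2)
      _ = volume D := by
          rw [← measure_inter_add_sdiff D (measurableSet_Iic (a := M + m)), Set.sdiff_eq,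
            Set.compl_Iic]
  have hreg : ∀ U : Set ℝ, MeasurableSet U →
      volume U = ⨆ (K : Set ℝ) (_ : K ⊆ U ∧ IsCompact K), volume K := fun U hU => by
    rw [hU.measure_eq_iSup_isCompact]
    exact iSup_congr fun K => iSup_and'
  rw [← hDv, hreg A hA, hreg B hB]
  exact ENNReal.biSup_add_biSup_le' ⟨∅, by simp, by simp⟩ ⟨∅, by simp, by simp⟩
    fun K hK L hL => key K L hK.1 hK.2 hL.1 hL.2

theorem ENNReal.mul_le_sq_of_add_le_two_mul {a b c : ℝ≥0∞} (h : a + b ≤ 2 * c) :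
    a * b ≤ c ^ 2 := by
  by_cases hc : c = ∞
  · simp [hc]
  have hab : a + b ≠ ∞ := ne_top_of_le_ne_top (ENNReal.mul_ne_top (by simp) hc) h
  lift c to NNReal using hc
  lift a to NNReal using fun ha => hab (by simp [ha])
  lift b to NNReal using fun hb => hab (by simp [hb])
  norm_cast at h ⊢
  rw [← NNReal.coe_le_coe] at h ⊢
  push_cast at h ⊢
  nlinarith [sq_nonneg ((a : ℝ) - b), a.2, b.2, c.2, a.coe_nonneg, b.coe_nonneg]

/-- The midpoint form of the Prékopa–Leindler inequality, as a property of a measure. -/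
def MidpointPrekopaLeindler {E : Type*} [AddCommGroup E] [Module ℝ E] [MeasurableSpace E]
    (μ : Measure E) : Prop :=
  ∀ F G H : E → ℝ≥0∞, Measurable F → Measurable G → Measurable H →
    (∀ u v, F u * G v ≤ H ((2⁻¹ : ℝ) • (u + v)) ^ 2) →
    (∫⁻ u, F u ∂μ) * ∫⁻ u, G u ∂μ ≤ (∫⁻ u, H u ∂μ) ^ 2

/-- By the layer-cake formula, Brunn–Minkowski for the superlevel sets at each height integrates to
`∫ F + ∫ G ≤ 2 ∫ H`, and AM-GM finishes. The common supremum `1` keeps both superlevel sets nonempty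
below height `1` and empty from there on. -/
theorem lintegral_mul_lintegral_le_sq_of_sup_eq_one {F G H : ℝ → ℝ}
    (hF : Measurable F) (hG : Measurable G) (hH : Measurable H)
    (hF0 : ∀ u, 0 ≤ F u) (hG0 : ∀ u, 0 ≤ G u) (hH0 : ∀ u, 0 ≤ H u)
    (hF1 : ∀ u, F u ≤ 1) (hG1 : ∀ u, G u ≤ 1)
    (hFs : ∀ s < 1, ∃ u, s < F u) (hGs : ∀ s < 1, ∃ u, s < G u)
    (h : ∀ u v, F u * G v ≤ H ((2⁻¹ : ℝ) * (u + v)) ^ 2) :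
    (∫⁻ u, ENNReal.ofReal (F u)) * ∫⁻ u, ENNReal.ofReal (G u)
      ≤ (∫⁻ u, ENNReal.ofReal (H u)) ^ 2 := by
  apply ENNReal.mul_le_sq_of_add_le_two_mul
  rw [lintegral_eq_lintegral_meas_lt _ (ae_of_all _ hF0) hF.aemeasurable,
    lintegral_eq_lintegral_meas_lt _ (ae_of_all _ hG0) hG.aemeasurable,
    lintegral_eq_lintegral_meas_lt _ (ae_of_all _ hH0) hH.aemeasurable]
  have anti : ∀ K : ℝ → ℝ, Measurable fun t => volume {a | t < K a} := fun K =>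
    (show Antitone fun t => volume {a | t < K a} from fun s t hst =>
      measure_mono fun a (ha : t < K a) => hst.trans_lt ha).measurable
  rw [← lintegral_add_left (anti F), ← lintegral_const_mul _ (anti H)]
  refine setLIntegral_mono ((anti H).const_mul _) fun s (hs : 0 < s) => ?_
  by_cases hs1 : s < 1
  · refine Real.volume_add_volume_le_two_mul_of_midpoints_subset
      (measurableSet_lt measurable_const hF) (measurableSet_lt measurable_const hG)
      (measurableSet_lt measurable_const hH) (hFs s hs1) (hGs s hs1) ?_
    intro u (hu : s < F u) v (hv : s < G v)
    refine lt_of_pow_lt_pow_left₀ 2 (hH0 _) (lt_of_lt_of_le ?_ (h u v))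
    nlinarith
  · have e1 : {a | s < F a} = ∅ := by
      ext a; simpa using (hF1 a).trans (not_lt.1 hs1)
    have e2 : {a | s < G a} = ∅ := by
      ext a; simpa using (hG1 a).trans (not_lt.1 hs1)
    simp [e1, e2]

theorem lintegral_mul_lintegral_le_sq_of_bounded {F G H : ℝ → ℝ} {C : ℝ}
    (hF : Measurable F) (hG : Measurable G) (hH : Measurable H)
    (hF0 : ∀ u, 0 ≤ F u) (hG0 : ∀ u, 0 ≤ G u) (hH0 : ∀ u, 0 ≤ H u)
    (hF1 : ∀ u, F u ≤ C) (hG1 : ∀ u, G u ≤ C)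
    (h : ∀ u v, F u * G v ≤ H ((2⁻¹ : ℝ) * (u + v)) ^ 2) :
    (∫⁻ u, ENNReal.ofReal (F u)) * ∫⁻ u, ENNReal.ofReal (G u)
      ≤ (∫⁻ u, ENNReal.ofReal (H u)) ^ 2 := by
  have bF : BddAbove (Set.range F) := ⟨C, by rintro _ ⟨u, rfl⟩; exact hF1 u⟩
  have bG : BddAbove (Set.range G) := ⟨C, by rintro _ ⟨u, rfl⟩; exact hG1 u⟩
  set a := ⨆ u, F u
  set b := ⨆ u, G u
  have hFa : ∀ u, F u ≤ a := le_ciSup bF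
  have hGb : ∀ u, G u ≤ b := le_ciSup bG
  rcases ((hF0 0).trans (hFa 0)).eq_or_lt with ha | ha
  · have : ∀ u, ENNReal.ofReal (F u) = 0 := fun u =>
      ENNReal.ofReal_of_nonpos ((hFa u).trans ha.ge)
    simp [this]
  rcases ((hG0 0).trans (hGb 0)).eq_or_lt with hb | hb
  · have : ∀ u, ENNReal.ofReal (G u) = 0 := fun u =>
      ENNReal.ofReal_of_nonpos ((hGb u).trans hb.ge)
    simp [this]
  -- Dividing `H` by the geometric mean of the two suprema preserves the pointwise hypothesis.
  set c := √(a * b)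
  have hc2 : c ^ 2 = a * b := Real.sq_sqrt (by positivity)
  have hc : 0 < c := Real.sqrt_pos.2 (by positivity)
  have key := lintegral_mul_lintegral_le_sq_of_sup_eq_one
    (F := fun u => F u / a) (G := fun u => G u / b) (H := fun u => H u / c)
    (hF.div_const _) (hG.div_const _) (hH.div_const _)
    (fun u => div_nonneg (hF0 u) ha.le) (fun u => div_nonneg (hG0 u) hb.le)
    (fun u => div_nonneg (hH0 u) hc.le)
    (fun u => (div_le_one ha).2 (hFa u)) (fun u => (div_le_one hb).2 (hGb u))
    (fun s hs => by
      obtain ⟨u, hu⟩ := exists_lt_of_lt_ciSup (show s * a < ⨆ u, F u by nlinarith)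
      exact ⟨u, (lt_div_iff₀ ha).2 hu⟩)
    (fun s hs => by
      obtain ⟨u, hu⟩ := exists_lt_of_lt_ciSup (show s * b < ⨆ u, G u by nlinarith)
      exact ⟨u, (lt_div_iff₀ hb).2 hu⟩)
    (fun u v => by
      rw [div_pow, hc2, div_mul_div_comm]
      gcongr
      exact h u v)
  have scale : ∀ (K : ℝ → ℝ) (r : ℝ), Measurable K → 0 < r →
      ∫⁻ u, ENNReal.ofReal (K u) =
        ENNReal.ofReal r * ∫⁻ u, ENNReal.ofReal (K u / r) := by
    intro K r hK hr
    rw [← lintegral_const_mul _ (by fun_prop)]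
    refine lintegral_congr fun u => ?_
    rw [← ENNReal.ofReal_mul hr.le, mul_div_cancel₀ _ hr.ne']
  rw [scale F a hF ha, scale G b hG hb, scale H c hH hc, mul_mul_mul_comm, mul_pow,
    ← ENNReal.ofReal_mul ha.le, ← ENNReal.ofReal_pow hc.le, hc2]
  gcongr

theorem midpointPrekopaLeindler_real : MidpointPrekopaLeindler (volume : Measure ℝ) := by
  intro F G H hF hG hH h
  have trunc : ∀ K : ℝ → ℝ≥0∞, Measurable K →
      ∫⁻ u, K u = ⨆ n : ℕ, ∫⁻ u, min (K u) n := by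
    intro K hK
    rw [← lintegral_iSup (fun n => hK.min measurable_const)
      (fun m n hmn u => min_le_min_left _ (by exact_mod_cast hmn))]
    refine lintegral_congr fun u => ?_
    change _ = ⨆ n : ℕ, K u ⊓ (n : ℝ≥0∞)
    rw [← inf_iSup_eq, ENNReal.iSup_natCast, inf_top_eq]
  -- Truncating all three functions at the same level `n` preserves the hypothesis; monotone
  -- convergence then removes the truncation.
  have step : ∀ n : ℕ, (∫⁻ u, min (F u) n) * (∫⁻ u, min (G u) n) ≤ (∫⁻ u, H u) ^ 2 := by
    intro n
    have hfin : ∀ x : ℝ≥0∞, min x (n : ℝ≥0∞) ≠ ∞ := fun x =>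
      ne_top_of_le_ne_top (by simp) (min_le_right _ _)
    have hle : ∀ x : ℝ≥0∞, (min x (n : ℝ≥0∞)).toReal ≤ n := fun x => by
      simpa using ENNReal.toReal_mono (by simp) (min_le_right x (n : ℝ≥0∞))
    have key := lintegral_mul_lintegral_le_sq_of_bounded
      (F := fun u => (min (F u) n).toReal) (G := fun u => (min (G u) n).toReal)
      (H := fun u => (min (H u) n).toReal) (C := n)
      (hF.min measurable_const).ennreal_toReal (hG.min measurable_const).ennreal_toReal
      (hH.min measurable_const).ennreal_toReal
      (fun _ => ENNReal.toReal_nonneg) (fun _ => ENNReal.toReal_nonneg)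
      (fun _ => ENNReal.toReal_nonneg) (fun _ => hle _) (fun _ => hle _)
      (fun u v => by
        rw [← ENNReal.toReal_mul, ← ENNReal.toReal_pow]
        refine ENNReal.toReal_mono (ENNReal.pow_ne_top (hfin _)) ?_
        rcases le_total (H ((2⁻¹ : ℝ) * (u + v))) n with hn | hn
        · rw [min_eq_left hn]
          exact (mul_le_mul' (min_le_left _ _) (min_le_left _ _)).trans (h u v)
        · rw [min_eq_right hn, sq]
          exact mul_le_mul' (min_le_right _ _) (min_le_right _ _))
    simp only [ENNReal.ofReal_toReal (hfin _)] at key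
    refine key.trans ?_
    gcongr
    exact min_le_left _ _
  rw [trunc F hF, trunc G hG, ENNReal.iSup_mul]
  refine iSup_le fun m => ?_
  rw [ENNReal.mul_iSup]
  refine iSup_le fun n => le_trans ?_ (step (max m n))
  gcongr <;> simp

/-- By Tonelli, the inequality on the fibres is exactly the hypothesis for the marginals. This
drives the induction on dimension. -/
theorem MidpointPrekopaLeindler.prod {E E' : Type*} [AddCommGroup E] [Module ℝ E]
    [MeasurableSpace E] [AddCommGroup E'] [Module ℝ E'] [MeasurableSpace E']
    {μ : Measure E} {ν : Measure E'} [SFinite ν]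
    (hμ : MidpointPrekopaLeindler μ) (hν : MidpointPrekopaLeindler ν) :
    MidpointPrekopaLeindler (μ.prod ν) := by
  intro F G H hF hG hH h
  rw [lintegral_prod _ hF.aemeasurable, lintegral_prod _ hG.aemeasurable,
    lintegral_prod _ hH.aemeasurable]
  refine hμ _ _ _ hF.lintegral_prod_right' hG.lintegral_prod_right' hH.lintegral_prod_right'
    fun u v => ?_
  exact hν _ _ _ (hF.comp measurable_prodMk_left) (hG.comp measurable_prodMk_left)
    (hH.comp measurable_prodMk_left) fun u' v' => h (u, u') (v, v')

theorem MidpointPrekopaLeindler.of_measurePreserving {E E' : Type*} [AddCommGroup E] [Module ℝ E]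
    [MeasurableSpace E] [AddCommGroup E'] [Module ℝ E'] [MeasurableSpace E']
    {μ : Measure E} {ν : Measure E'} (hμ : MidpointPrekopaLeindler μ) (e : E → E')
    (he : MeasurePreserving e μ ν)
    (hmid : ∀ u v, e ((2⁻¹ : ℝ) • (u + v)) = (2⁻¹ : ℝ) • (e u + e v)) :
    MidpointPrekopaLeindler ν := by
  intro F G H hF hG hH h
  rw [← he.lintegral_comp hF, ← he.lintegral_comp hG, ← he.lintegral_comp hH]
  refine hμ _ _ _ (hF.comp he.measurable) (hG.comp he.measurable) (hH.comp he.measurable)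
    fun u v => ?_
  simpa only [Function.comp, hmid] using h (e u) (e v)

theorem midpointPrekopaLeindler_pi (n : ℕ) :
    MidpointPrekopaLeindler (volume : Measure (Fin n → ℝ)) := by
  induction n with
  | zero =>
    intro F G H hF hG hH h
    simp only [Measure.volume_pi_eq_dirac (0 : Fin 0 → ℝ), lintegral_dirac]
    simpa using h 0 0
  | succ n ih =>
    refine (midpointPrekopaLeindler_real.prod ih).of_measurePreserving
      (MeasurableEquiv.piFinSuccAbove (fun _ => ℝ) 0).symm
      (volume_preserving_piFinSuccAbove (fun _ : Fin (n + 1) => ℝ) 0).symm ?_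
    intro u v
    ext i
    refine Fin.cases ?_ (fun j => ?_) i <;> simp [MeasurableEquiv.piFinSuccAbove] <;> ring

theorem midpointPrekopaLeindler_euclideanSpace (n : ℕ) :
    MidpointPrekopaLeindler (volume : Measure (EuclideanSpace ℝ (Fin n))) :=
  (midpointPrekopaLeindler_pi n).of_measurePreserving _ (PiLp.volume_preserving_toLp (Fin n))
    fun _ _ => rfl

/-! ### Convex functions with a quadratic upper model, and gradient descent. -/

section ProximalGradient

open Filter Topology

variable {E : Type*} [NormedAddCommGroup E] [InnerProductSpace ℝ E]

/-- A midpoint convex function with a quadratic upper model lies above its linear models. -/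
theorem add_inner_le_of_midpoint_convex {h : E → ℝ} {g : E → E} {lam : ℝ}
    (hup : ∀ x y, h y ≤ h x + inner ℝ (g x) (y - x) + ‖y - x‖ ^ 2 / (2 * lam))
    (hmid : ∀ x y, 2 * h ((2⁻¹ : ℝ) • (x + y)) ≤ h x + h y) (x y : E) :
    h x + inner ℝ (g x) (y - x) ≤ h y := by
  set w := y - x with hw
  -- Since `x` is the midpoint of `x ± s • w`, the upper model at `x - s • w` becomes a lower model
  -- at `x + s • w`. Only dyadic `s` is then needed, so full convexity never has to be derived.
  have hlow : ∀ s : ℝ, h x + s * inner ℝ (g x) w - s ^ 2 * (‖w‖ ^ 2 / (2 * lam))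
      ≤ h (x + s • w) := by
    intro s
    have h1 := hup x (x - s • w)
    have h2 := hmid (x + s • w) (x - s • w)
    have e1 : x - s • w - x = -(s • w) := by abel
    have e2 : (2⁻¹ : ℝ) • (x + s • w + (x - s • w)) = x := by
      rw [show x + s • w + (x - s • w) = (2 : ℝ) • x by rw [two_smul]; abel, smul_smul]
      norm_num
    rw [e1, norm_neg, norm_smul, inner_neg_right, real_inner_smul_right, mul_pow,
      Real.norm_eq_abs, sq_abs, mul_div_assoc] at h1
    rw [e2] at h2
    linarith
  have hdyadic : ∀ n : ℕ, h (x + ((2⁻¹ : ℝ) ^ n) • w) ≤ h x + (2⁻¹ : ℝ) ^ n * (h y - h x) := by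
    intro n
    induction n with
    | zero => simp [hw]
    | succ n ih =>
      have h2 := hmid x (x + ((2⁻¹ : ℝ) ^ n) • w)
      have e2 : (2⁻¹ : ℝ) • (x + (x + ((2⁻¹ : ℝ) ^ n) • w)) = x + ((2⁻¹ : ℝ) ^ (n + 1)) • w := by
        rw [← add_assoc, ← two_smul ℝ x, smul_add, smul_smul, smul_smul, pow_succ']
        norm_num
      rw [e2, pow_succ'] at h2
      rw [pow_succ']
      linarith
  have hbound : ∀ n : ℕ,
      inner ℝ (g x) w - (2⁻¹ : ℝ) ^ n * (‖w‖ ^ 2 / (2 * lam)) ≤ h y - h x := by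
    intro n
    have hp : (0 : ℝ) < (2⁻¹ : ℝ) ^ n := by positivity
    have := (hlow ((2⁻¹ : ℝ) ^ n)).trans (hdyadic n)
    refine le_of_mul_le_mul_left ?_ hp
    linarith
  have hlim : Tendsto (fun n : ℕ => inner ℝ (g x) w - (2⁻¹ : ℝ) ^ n * (‖w‖ ^ 2 / (2 * lam)))
      atTop (𝓝 (inner ℝ (g x) w - 0 * (‖w‖ ^ 2 / (2 * lam)))) :=
    tendsto_const_nhds.sub
      ((tendsto_pow_atTop_nhds_zero_of_lt_one (by norm_num) (by norm_num)).mul_const _)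
  have := le_of_tendsto' hlim hbound
  linarith

theorem hasGradientAt_of_quadratic_sandwich [CompleteSpace E] {h : E → ℝ} {g : E → E} {lam : ℝ}
    (hup : ∀ x y, h y ≤ h x + inner ℝ (g x) (y - x) + ‖y - x‖ ^ 2 / (2 * lam))
    (hlow : ∀ x y, h x + inner ℝ (g x) (y - x) ≤ h y) (x : E) :
    HasGradientAt h (g x) x := by
  rw [hasGradientAt_iff_isLittleO]
  have hO : (fun y => h y - h x - inner ℝ (g x) (y - x)) =O[𝓝 x] fun y => ‖y - x‖ ^ 2 := by
    refine Asymptotics.IsBigO.of_bound (1 / (2 * lam)) (Eventually.of_forall fun y => ?_)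
    have h1 := hup x y
    have h2 := hlow x y
    rw [Real.norm_of_nonneg (by linarith), Real.norm_of_nonneg (by positivity),
      one_div_mul_eq_div]
    linarith
  refine hO.trans_isLittleO ?_
  have : (fun y : E => ‖y - x‖ ^ 2) =o[𝓝 x] fun y => ‖y - x‖ :=
    Asymptotics.IsLittleO.comp_tendsto (g := fun r : ℝ => r) (f := fun r : ℝ => r ^ 2) (l := 𝓝 0)
      (by simpa using Asymptotics.isLittleO_pow_pow (𝕜 := ℝ) (show 1 < 2 by norm_num))
      (tendsto_norm_sub_self x)
  exact this.of_norm_right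

variable {h : E → ℝ} {g : E → E} {lam : ℝ}

/-- The linear lower model at `x` and the quadratic upper model at `y` are compared at `y + lam • (g
x - g y)`, where the comparison is sharpest. -/
theorem add_inner_add_norm_sq_le_of_quadratic_sandwich (hlam : 0 < lam)
    (hup : ∀ x y, h y ≤ h x + inner ℝ (g x) (y - x) + ‖y - x‖ ^ 2 / (2 * lam))
    (hlow : ∀ x y, h x + inner ℝ (g x) (y - x) ≤ h y) (x y : E) :
    h x + inner ℝ (g x) (y - x) + lam / 2 * ‖g x - g y‖ ^ 2 ≤ h y := by
  set r := g x - g y with hr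
  have h1 := hup y (y + lam • r)
  have h2 := hlow x (y + lam • r)
  rw [add_sub_cancel_left, norm_smul, mul_pow, Real.norm_eq_abs, sq_abs,
    real_inner_smul_right] at h1
  rw [add_sub_right_comm, inner_add_right, real_inner_smul_right] at h2
  have h3 : inner ℝ (g x) r - inner ℝ (g y) r = ‖r‖ ^ 2 := by
    rw [← inner_sub_left, ← hr, real_inner_self_eq_norm_sq]
  have h4 : lam ^ 2 * ‖r‖ ^ 2 / (2 * lam) = lam / 2 * ‖r‖ ^ 2 := by field_simp
  have h5 : lam * inner ℝ (g x) r - lam * inner ℝ (g y) r = lam * ‖r‖ ^ 2 := by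
    rw [← mul_sub, h3]
  linarith

theorem cocoercive_of_quadratic_sandwich (hlam : 0 < lam)
    (hup : ∀ x y, h y ≤ h x + inner ℝ (g x) (y - x) + ‖y - x‖ ^ 2 / (2 * lam))
    (hlow : ∀ x y, h x + inner ℝ (g x) (y - x) ≤ h y) (x y : E) :
    lam * ‖g x - g y‖ ^ 2 ≤ inner ℝ (g x - g y) (x - y) := by
  have h1 := add_inner_add_norm_sq_le_of_quadratic_sandwich hlam hup hlow x y
  have h2 := add_inner_add_norm_sq_le_of_quadratic_sandwich hlam hup hlow y x
  rw [norm_sub_rev (g y)] at h2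
  rw [← neg_sub x y, inner_neg_right] at h1
  rw [inner_sub_left]
  linarith

theorem norm_apply_sub_smul_le_of_quadratic_sandwich (hlam : 0 < lam)
    (hup : ∀ x y, h y ≤ h x + inner ℝ (g x) (y - x) + ‖y - x‖ ^ 2 / (2 * lam))
    (hlow : ∀ x y, h x + inner ℝ (g x) (y - x) ≤ h y) (x : E) :
    ‖g (x - lam • g x)‖ ≤ ‖g x‖ := by
  set p := g (x - lam • g x)
  have h1 := cocoercive_of_quadratic_sandwich hlam hup hlow x (x - lam • g x)
  rw [sub_sub_cancel, real_inner_smul_right] at h1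
  have h2 : ‖g x - p‖ ^ 2 ≤ inner ℝ (g x - p) (g x) := le_of_mul_le_mul_left h1 hlam
  rw [norm_sub_sq_real, inner_sub_left, real_inner_self_eq_norm_sq, real_inner_comm] at h2
  have h3 := real_inner_le_norm p (g x)
  nlinarith [norm_nonneg p, norm_nonneg (g x)]

theorem apply_eq_zero_of_forall_le (hlam : 0 < lam)
    (hup : ∀ x y, h y ≤ h x + inner ℝ (g x) (y - x) + ‖y - x‖ ^ 2 / (2 * lam))
    {z : E} (hz : ∀ y, h z ≤ h y) : g z = 0 := by
  have h1 := hup z (z - lam • g z)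
  have h2 := hz (z - lam • g z)
  rw [sub_sub_cancel_left, inner_neg_right, real_inner_smul_right, real_inner_self_eq_norm_sq,
    norm_neg, norm_smul, mul_pow, Real.norm_eq_abs, sq_abs,
    show lam ^ 2 * ‖g z‖ ^ 2 / (2 * lam) = lam / 2 * ‖g z‖ ^ 2 by field_simp] at h1
  have h3 : lam * ‖g z‖ ^ 2 ≤ 0 := by linarith
  have h4 : ‖g z‖ ^ 2 ≤ 0 := by
    by_contra hc
    exact absurd h3 (not_le.2 (mul_pos hlam (not_le.1 hc)))
  exact norm_eq_zero.1 (pow_eq_zero_iff two_ne_zero |>.1 (le_antisymm h4 (by positivity)))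

/-- Gradient descent with step `lam` on a convex `1 / lam`-smooth function drives the gradient
norm to zero at rate `1 / k`. -/
theorem norm_gradient_descent_le (hlam : 0 < lam)
    (hup : ∀ x y, h y ≤ h x + inner ℝ (g x) (y - x) + ‖y - x‖ ^ 2 / (2 * lam))
    (hlow : ∀ x y, h x + inner ℝ (g x) (y - x) ≤ h y)
    {z : E} (hz : ∀ y, h z ≤ h y) {x : ℕ → E} (hx : ∀ k, x (k + 1) = x k - lam • g (x k)) (k : ℕ) :
    ‖g (x k)‖ ≤ 2 * ‖x 0 - z‖ / (lam * (k + 1)) := by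
  have hgz := apply_eq_zero_of_forall_le hlam hup hz
  have hgap : ∀ j, h (x j) - h z + lam / 2 * ‖g (x j)‖ ^ 2 ≤ inner ℝ (g (x j)) (x j - z) := by
    intro j
    have := add_inner_add_norm_sq_le_of_quadratic_sandwich hlam hup hlow (x j) z
    rw [hgz, sub_zero, ← neg_sub (x j) z, inner_neg_right] at this
    linarith
  have hgap' : ∀ j, lam / 2 * ‖g (x j)‖ ^ 2 ≤ h (x j) - h z := by
    intro j
    have := add_inner_add_norm_sq_le_of_quadratic_sandwich hlam hup hlow z (x j)
    rw [hgz, zero_sub, norm_neg, inner_zero_left] at this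
    linarith
  have hdist : ∀ j, lam ^ 2 * ‖g (x j)‖ ^ 2 ≤ ‖x j - z‖ ^ 2 := by
    intro j
    have h1 := hgap j
    have h2 := hgap' j
    have h3 := real_inner_le_norm (g (x j)) (x j - z)
    have h4 : lam * ‖g (x j)‖ ≤ ‖x j - z‖ := by
      rcases (norm_nonneg (g (x j))).eq_or_lt with h0 | h0
      · rw [← h0, mul_zero]; positivity
      · refine le_of_mul_le_mul_left ?_ h0
        nlinarith
    rw [← mul_pow]
    gcongr
  have hdescent : ∀ j, h (x (j + 1)) ≤ h (x j) - lam / 2 * ‖g (x j)‖ ^ 2 := by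
    intro j
    have h1 := hup (x j) (x (j + 1))
    rw [hx, sub_sub_cancel_left, inner_neg_right, real_inner_smul_right,
      real_inner_self_eq_norm_sq, norm_neg, norm_smul, mul_pow, Real.norm_eq_abs, sq_abs,
      show lam ^ 2 * ‖g (x j)‖ ^ 2 / (2 * lam) = lam / 2 * ‖g (x j)‖ ^ 2 by field_simp] at h1
    rw [hx]
    linarith
  have hcontr : ∀ j, ‖x (j + 1) - z‖ ^ 2 ≤ ‖x j - z‖ ^ 2 - 2 * lam * (h (x j) - h z) := by
    intro j
    rw [hx, sub_right_comm, norm_sub_sq_real, norm_smul, mul_pow, Real.norm_eq_abs, sq_abs,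
      real_inner_smul_right, real_inner_comm]
    nlinarith [hgap j]
  have hmono : ∀ j, ‖g (x (j + 1))‖ ^ 2 ≤ ‖g (x j)‖ ^ 2 := by
    intro j
    rw [hx]
    have := norm_apply_sub_smul_le_of_quadratic_sandwich hlam hup hlow (x j)
    gcongr
  -- The left side is nonincreasing in `j`: `hcontr` pays for raising the weight of the gap from `j`
  -- to `j + 1`, and the decrease in `hdescent` pays exactly for the growth of the last weight,
  -- because `(j + 1)(j + 2) / 2 - j (j + 1) / 2 = j + 1`.
  have hlyap : ∀ j : ℕ, ‖x j - z‖ ^ 2 + 2 * lam * j * (h (x j) - h z)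
      + lam ^ 2 * (j * (j + 1) / 2) * ‖g (x j)‖ ^ 2 ≤ ‖x 0 - z‖ ^ 2 := by
    intro j
    induction j with
    | zero => simp
    | succ j ih =>
      refine le_trans ?_ ih
      push_cast
      have h1 := hcontr j
      have h2 := mul_le_mul_of_nonneg_left (hdescent j)
        (show 0 ≤ 2 * lam * (j + 1) by positivity)
      have h3 := mul_le_mul_of_nonneg_left (hmono j)
        (show 0 ≤ lam ^ 2 * ((j + 1) * (j + 1 + 1) / 2 : ℝ) by positivity)
      linarith
  have h1 := hlyap k
  have h2 := hdist k
  have h3 := mul_le_mul_of_nonneg_left (hgap' k) (show 0 ≤ 2 * lam * k by positivity)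
  -- Together `h1`, `h2`, `h3` give `lam² (k + 1)(k + 2) / 2 * ‖g (x k)‖² ≤ ‖x 0 - z‖²`, which is
  -- stronger than needed; `h5` and `h6` discard the slack.
  have h4 : (lam * (k + 1) * ‖g (x k)‖) ^ 2 ≤ (2 * ‖x 0 - z‖) ^ 2 := by
    have h5 : 0 ≤ lam ^ 2 * (k + 1) * ‖g (x k)‖ ^ 2 := by positivity
    have h6 : 0 ≤ ‖x 0 - z‖ ^ 2 := by positivity
    linarith
  rw [le_div_iff₀ (by positivity), mul_comm]
  exact le_of_sq_le_sq h4 (by positivity)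

end ProximalGradient

/-! ### The isotropic Gaussian as an explicit Lebesgue density. -/

section Gaussian

variable {d : ℕ}

theorem integrable_exp_neg_norm_sub_sq_div {V : Type*} [NormedAddCommGroup V]
    [InnerProductSpace ℝ V] [FiniteDimensional ℝ V] [MeasurableSpace V] [BorelSpace V]
    (x : V) {v : ℝ} (hv : 0 < v) :
    Integrable (fun y : V => Real.exp (-(‖y - x‖ ^ 2 / (2 * v)))) := by
  have hb : (0 : ℝ) < (2 * v)⁻¹ := by positivity
  have h0 : Integrable (fun y : V => Real.exp (-(‖y‖ ^ 2 / (2 * v)))) := by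
    refine Integrable.of_integral_ne_zero ?_
    have := GaussianFourier.integral_rexp_neg_mul_sq_norm (V := V) hb
    simp only [show ∀ y : V, -(‖y‖ ^ 2 / (2 * v)) = -(2 * v)⁻¹ * ‖y‖ ^ 2 by intro y; ring]
    rw [this]
    positivity
  exact h0.comp_sub_right x

/-- Both sides have the same characteristic function. This turns Gaussian expectations into Lebesgue
integrals, where dilations, translations and Prékopa–Leindler apply. -/
theorem isoGaussian_eq_tilted (x : EuclideanSpace ℝ (Fin d)) {v : ℝ} (hv : 0 < v) :
    isoGaussian x v = (volume : Measure (EuclideanSpace ℝ (Fin d))).tilted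
      (fun y => -(‖y - x‖ ^ 2 / (2 * v))) := by
  have hint := integrable_exp_neg_norm_sub_sq_div x hv
  have := isProbabilityMeasure_tilted hint
  have hpos : (v • (1 : Matrix (Fin d) (Fin d) ℝ)).PosSemidef := Matrix.PosSemidef.one.smul hv.le
  unfold isoGaussian
  refine Measure.ext_of_charFun ?_
  ext t
  rw [charFun_multivariateGaussian hpos, charFun_apply, integral_tilted]
  set N := ∫ y : EuclideanSpace ℝ (Fin d), Real.exp (-(‖y - x‖ ^ 2 / (2 * v))) with hN
  have hN0 : 0 < N := integral_exp_pos hint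
  set b : ℂ := (((2 * v)⁻¹ : ℝ) : ℂ) with hb
  have hbre : 0 < b.re := by rw [hb, Complex.ofReal_re]; positivity
  have hNc : (N : ℂ) =
      (Real.pi / b) ^ (Module.finrank ℝ (EuclideanSpace ℝ (Fin d)) / 2 : ℂ) := by
    rw [← GaussianFourier.integral_cexp_neg_mul_sq_norm hbre, hN,
      integral_sub_right_eq_self (fun y : EuclideanSpace ℝ (Fin d) =>
        Real.exp (-(‖y‖ ^ 2 / (2 * v)))) x, ← integral_complex_ofReal]
    refine integral_congr_ae (ae_of_all _ fun y => ?_)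
    simp only [hb]
    push_cast
    congr 1
    ring
  have hF : ∫ y : EuclideanSpace ℝ (Fin d), Complex.exp (-b * ‖y‖ ^ 2 + Complex.I * inner ℝ t y)
      = N * Complex.exp (-(v * ‖t‖ ^ 2 / 2)) := by
    rw [GaussianFourier.integral_cexp_neg_mul_sq_norm_add hbre, ← hNc, Complex.I_sq, hb]
    congr 2
    have : (v : ℂ) ≠ 0 := by exact_mod_cast hv.ne'
    push_cast
    field_simp
    ring
  have hshift : ∀ y : EuclideanSpace ℝ (Fin d),
      (Real.exp (-(‖y - x‖ ^ 2 / (2 * v))) / N) • Complex.exp (inner ℝ y t * Complex.I) =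
      (Complex.exp (inner ℝ t x * Complex.I) / N) *
        Complex.exp (-b * ‖y - x‖ ^ 2 + Complex.I * inner ℝ t (y - x)) := by
    intro y
    rw [Complex.real_smul, inner_sub_right, real_inner_comm]
    push_cast
    rw [div_mul_eq_mul_div, div_mul_eq_mul_div, ← Complex.exp_add, ← Complex.exp_add, hb]
    congr 2
    push_cast
    ring
  have hNc0 : (N : ℂ) ≠ 0 := by exact_mod_cast hN0.ne'
  simp_rw [hshift]
  rw [integral_const_mul, integral_sub_right_eq_self (fun y : EuclideanSpace ℝ (Fin d) =>
    Complex.exp (-b * ‖y‖ ^ 2 + Complex.I * inner ℝ t y)) x, hF, div_mul_eq_mul_div,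
    mul_left_comm, mul_div_cancel_left₀ _ hNc0, ← Complex.exp_add]
  congr 1
  have : t.ofLp ⬝ᵥ (v • (1 : Matrix (Fin d) (Fin d) ℝ)).mulVec t.ofLp = v * ‖t‖ ^ 2 := by
    rw [Matrix.smul_mulVec, Matrix.one_mulVec, dotProduct_smul, EuclideanSpace.real_norm_sq_eq,
      smul_eq_mul, dotProduct]
    simp only [sq]
  rw [this]
  push_cast
  ring

end Gaussian

/-! ### The Gibbs variational inequality. -/

/-- The Gibbs variational inequality: raising the exponent by at least `u` raises the partition
function by at least the exponential of the mean of `u`. -/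
theorem exp_integral_tilted_mul_le {α : Type*} [MeasurableSpace α] {μ : Measure α} [NeZero μ]
    {p q u : α → ℝ} (hp : Integrable (fun y => Real.exp (p y)) μ)
    (hq : Integrable (fun y => Real.exp (q y)) μ) (hu : Integrable u (μ.tilted p))
    (h : ∀ y, p y + u y ≤ q y) :
    Real.exp (∫ y, u y ∂(μ.tilted p)) * ∫ y, Real.exp (p y) ∂μ ≤ ∫ y, Real.exp (q y) ∂μ := by
  have := isProbabilityMeasure_tilted hp
  set a := ∫ y, u y ∂(μ.tilted p) with ha
  have hZ : 0 < ∫ y, Real.exp (p y) ∂μ := integral_exp_pos hp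
  have hu' := (integrable_tilted_iff hp u).1 hu
  have hmean : ∫ y, Real.exp (p y) • u y ∂μ = a * ∫ y, Real.exp (p y) ∂μ := by
    rw [ha, integral_tilted, ← integral_mul_const]
    refine integral_congr_ae (ae_of_all _ fun y => ?_)
    simp only [smul_eq_mul]
    field_simp
  -- The tangent line of `exp` at the mean `a` is integrated, its linear term averaging to zero;
  -- integrability of `exp ∘ u` is thus not needed.
  calc Real.exp a * ∫ y, Real.exp (p y) ∂μ
      = ∫ y, Real.exp a * ((1 - a) * Real.exp (p y) + Real.exp (p y) • u y) ∂μ := by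
        rw [integral_const_mul, integral_add (hp.const_mul _) hu', integral_const_mul, hmean]
        ring
    _ ≤ ∫ y, Real.exp (q y) ∂μ := by
        refine integral_mono (((hp.const_mul _).add hu').const_mul _) hq fun y => ?_
        have h1 := Real.add_one_le_exp (u y - a)
        calc Real.exp a * ((1 - a) * Real.exp (p y) + Real.exp (p y) • u y)
            = Real.exp a * Real.exp (p y) * (u y - a + 1) := by simp only [smul_eq_mul]; ring
          _ ≤ Real.exp a * Real.exp (p y) * Real.exp (u y - a) := by gcongr
          _ = Real.exp (p y + u y) := by rw [← Real.exp_add, ← Real.exp_add]; congr 1; ring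
          _ ≤ Real.exp (q y) := Real.exp_le_exp.2 (h y)

/-! ### The Gibbs measure: normalization, mean and moments. -/

section Gibbs

variable {d : ℕ}

/-- The exponent of the unnormalized density of `exp (-f / δ) 𝒩(x, lam δ I)`. -/
noncomputable def gibbsExponent (f : EuclideanSpace ℝ (Fin d) → ℝ) (lam δ : ℝ)
    (x y : EuclideanSpace ℝ (Fin d)) : ℝ :=
  -(‖y - x‖ ^ 2 / (2 * (lam * δ))) + -f y / δ

/-- The total mass of the unnormalized Gibbs density. -/
noncomputable def gibbsPartition (f : EuclideanSpace ℝ (Fin d) → ℝ) (lam δ : ℝ)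
    (x : EuclideanSpace ℝ (Fin d)) : ℝ :=
  ∫ y, Real.exp (gibbsExponent f lam δ x y)

/-- The probability measure proportional to `exp (-f / δ) 𝒩(x, lam δ I)`. -/
noncomputable def gibbsMeasure (f : EuclideanSpace ℝ (Fin d) → ℝ) (lam δ : ℝ)
    (x : EuclideanSpace ℝ (Fin d)) : Measure (EuclideanSpace ℝ (Fin d)) :=
  volume.tilted (gibbsExponent f lam δ x)

variable {f : EuclideanSpace ℝ (Fin d) → ℝ} {lam δ : ℝ}

theorem continuous_gibbsExponent (hf : Continuous f) (x : EuclideanSpace ℝ (Fin d)) :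
    Continuous (gibbsExponent f lam δ x) := by
  unfold gibbsExponent
  fun_prop

theorem exp_gibbsExponent_le (hlam : 0 < lam) (hδ : 0 < δ) (x y : EuclideanSpace ℝ (Fin d)) :
    Real.exp (gibbsExponent f lam δ x y) ≤ Real.exp (-f y / δ) := by
  rw [Real.exp_le_exp, gibbsExponent]
  have : 0 ≤ ‖y - x‖ ^ 2 / (2 * (lam * δ)) := by positivity
  linarith

theorem integrable_exp_gibbsExponent (hlam : 0 < lam) (hδ : 0 < δ) (hf : StandingAssumption f δ)
    (x : EuclideanSpace ℝ (Fin d)) :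
    Integrable (fun y => Real.exp (gibbsExponent f lam δ x y)) := by
  refine hf.integrable_exp.mono'
    (Real.continuous_exp.comp (continuous_gibbsExponent hf.continuous x)).aestronglyMeasurable
    (ae_of_all _ fun y => ?_)
  rw [Real.norm_of_nonneg (Real.exp_pos _).le]
  exact exp_gibbsExponent_le hlam hδ x y

theorem gibbsPartition_pos (hlam : 0 < lam) (hδ : 0 < δ) (hf : StandingAssumption f δ)
    (x : EuclideanSpace ℝ (Fin d)) : 0 < gibbsPartition f lam δ x :=
  integral_exp_pos (integrable_exp_gibbsExponent hlam hδ hf x)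

theorem isProbabilityMeasure_gibbsMeasure (hlam : 0 < lam) (hδ : 0 < δ)
    (hf : StandingAssumption f δ) (x : EuclideanSpace ℝ (Fin d)) :
    IsProbabilityMeasure (gibbsMeasure f lam δ x) :=
  isProbabilityMeasure_tilted (integrable_exp_gibbsExponent hlam hδ hf x)

theorem integral_exp_isoGaussian (hlam : 0 < lam) (hδ : 0 < δ) (x : EuclideanSpace ℝ (Fin d)) :
    ∫ y, Real.exp (-f y / δ) ∂(isoGaussian x (lam * δ)) = gibbsPartition f lam δ x /
      ∫ y : EuclideanSpace ℝ (Fin d), Real.exp (-(‖y‖ ^ 2 / (2 * (lam * δ)))) := by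
  rw [isoGaussian_eq_tilted x (mul_pos hlam hδ), integral_exp_tilted,
    integral_sub_right_eq_self (fun y : EuclideanSpace ℝ (Fin d) =>
        Real.exp (-(‖y‖ ^ 2 / (2 * (lam * δ))))) x]
  rfl

theorem softMoreau_eq (hlam : 0 < lam) (hδ : 0 < δ) (hf : StandingAssumption f δ)
    (x : EuclideanSpace ℝ (Fin d)) :
    softMoreau f lam δ x = -δ * Real.log (gibbsPartition f lam δ x) + δ * Real.log
      (∫ y : EuclideanSpace ℝ (Fin d), Real.exp (-(‖y‖ ^ 2 / (2 * (lam * δ))))) := by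
  have h := integrable_exp_neg_norm_sub_sq_div (0 : EuclideanSpace ℝ (Fin d)) (mul_pos hlam hδ)
  simp only [sub_zero] at h
  rw [softMoreau, integral_exp_isoGaussian hlam hδ,
    Real.log_div (gibbsPartition_pos hlam hδ hf x).ne' (integral_exp_pos h).ne']
  ring

theorem zprox_eq (hlam : 0 < lam) (hδ : 0 < δ) (x : EuclideanSpace ℝ (Fin d)) :
    zprox f lam δ x = ∫ y, y ∂(gibbsMeasure f lam δ x) := by
  have hG := integrable_exp_neg_norm_sub_sq_div x (mul_pos hlam hδ)
  have hsum : gibbsExponent f lam δ x =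
      (fun y => -(‖y - x‖ ^ 2 / (2 * (lam * δ)))) + fun y => -f y / δ := rfl
  rw [zprox, gibbsMeasure, hsum, ← tilted_tilted hG, ← isoGaussian_eq_tilted x (mul_pos hlam hδ),
    integral_tilted (fun y => -f y / δ), ← integral_smul]
  simp only [smul_smul, div_eq_inv_mul]

/-- Since `r * exp (-r) ≤ 1`, the Gaussian factor absorbs the square and `exp (-f / δ)` is an
integrable majorant. -/
theorem integrable_norm_sub_sq_gibbsMeasure (hlam : 0 < lam) (hδ : 0 < δ)
    (hf : StandingAssumption f δ) (x : EuclideanSpace ℝ (Fin d)) :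
    Integrable (fun y => ‖y - x‖ ^ 2) (gibbsMeasure f lam δ x) := by
  refine (integrable_tilted_iff (integrable_exp_gibbsExponent hlam hδ hf x) _).2 ?_
  refine (hf.integrable_exp.const_mul (2 * (lam * δ))).mono'
    (((Real.continuous_exp.comp (continuous_gibbsExponent hf.continuous x))).smul
      (by fun_prop)).aestronglyMeasurable (ae_of_all _ fun y => ?_)
  have hv : 0 < 2 * (lam * δ) := by positivity
  rw [smul_eq_mul, Real.norm_of_nonneg (by positivity), gibbsExponent, Real.exp_add,
    mul_right_comm]
  refine mul_le_mul_of_nonneg_right ?_ (Real.exp_pos _).le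
  set r := ‖y - x‖ ^ 2 / (2 * (lam * δ)) with hr
  have h1 : ‖y - x‖ ^ 2 = 2 * (lam * δ) * r := by rw [hr]; field_simp
  have h2 := Real.add_one_le_exp r
  rw [h1, Real.exp_neg, inv_mul_le_iff₀ (Real.exp_pos _)]
  nlinarith

theorem integrable_sub_gibbsMeasure (hlam : 0 < lam) (hδ : 0 < δ)
    (hf : StandingAssumption f δ) (x : EuclideanSpace ℝ (Fin d)) :
    Integrable (fun y => y - x) (gibbsMeasure f lam δ x) := by
  have := isProbabilityMeasure_gibbsMeasure hlam hδ hf x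
  refine ((integrable_norm_sub_sq_gibbsMeasure hlam hδ hf x).add (integrable_const 1)).mono'
    (by fun_prop) (ae_of_all _ fun y => ?_)
  simp only [Pi.add_apply]
  nlinarith [sq_nonneg (‖y - x‖ - 1), norm_nonneg (y - x)]

theorem integrable_id_gibbsMeasure (hlam : 0 < lam) (hδ : 0 < δ)
    (hf : StandingAssumption f δ) (x : EuclideanSpace ℝ (Fin d)) :
    Integrable (fun y => y) (gibbsMeasure f lam δ x) := by
  have := isProbabilityMeasure_gibbsMeasure hlam hδ hf x
  exact ((integrable_sub_gibbsMeasure hlam hδ hf x).add (integrable_const x)).congr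
    (ae_of_all _ fun y => by simp)

theorem integral_sub_gibbsMeasure (hlam : 0 < lam) (hδ : 0 < δ)
    (hf : StandingAssumption f δ) (x z : EuclideanSpace ℝ (Fin d)) :
    ∫ y, (y - z) ∂(gibbsMeasure f lam δ x) = zprox f lam δ x - z := by
  have := isProbabilityMeasure_gibbsMeasure hlam hδ hf x
  rw [integral_sub (integrable_id_gibbsMeasure hlam hδ hf x) (integrable_const _), zprox_eq hlam hδ]
  simp

theorem integrable_inner_sub_gibbsMeasure (hlam : 0 < lam) (hδ : 0 < δ)
    (hf : StandingAssumption f δ) (x z w : EuclideanSpace ℝ (Fin d)) :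
    Integrable (fun y => inner ℝ (y - z) (y - w)) (gibbsMeasure f lam δ x) := by
  have := isProbabilityMeasure_gibbsMeasure hlam hδ hf x
  have h := integrable_sub_gibbsMeasure hlam hδ hf x
  refine ((integrable_norm_sub_sq_gibbsMeasure hlam hδ hf x).add
    (((h.inner_const (x - w)).add (h.const_inner (x - z))).add
      (integrable_const (inner ℝ (x - z) (x - w))))).congr (ae_of_all _ fun y => ?_)
  dsimp only
  rw [← sub_add_sub_cancel y x z, ← sub_add_sub_cancel y x w]
  simp only [Pi.add_apply, inner_add_left, inner_add_right, real_inner_self_eq_norm_sq]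
  ring

theorem integrable_norm_sub_sq_gibbsMeasure' (hlam : 0 < lam) (hδ : 0 < δ)
    (hf : StandingAssumption f δ) (x z : EuclideanSpace ℝ (Fin d)) :
    Integrable (fun y => ‖y - z‖ ^ 2) (gibbsMeasure f lam δ x) := by
  simpa only [real_inner_self_eq_norm_sq] using
    integrable_inner_sub_gibbsMeasure hlam hδ hf x z z

/-- The roles are exchanged: `exp (-f / δ)` absorbs `f - min f`, and the Gaussian factor is the
integrable majorant. -/
theorem integrable_gibbsMeasure (hlam : 0 < lam) (hδ : 0 < δ)
    (hf : StandingAssumption f δ) (x : EuclideanSpace ℝ (Fin d)) :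
    Integrable f (gibbsMeasure f lam δ x) := by
  have := isProbabilityMeasure_gibbsMeasure hlam hδ hf x
  obtain ⟨z, hz⟩ := hf.exists_minimizer
  suffices h : Integrable (fun y => f y - f z) (gibbsMeasure f lam δ x) by
    exact (h.add (integrable_const (f z))).congr (ae_of_all _ fun y => by simp)
  refine (integrable_tilted_iff (integrable_exp_gibbsExponent hlam hδ hf x) _).2 ?_
  have hG := integrable_exp_neg_norm_sub_sq_div x (mul_pos hlam hδ)
  refine (hG.const_mul (δ * Real.exp (-f z / δ))).mono'
    (((Real.continuous_exp.comp (continuous_gibbsExponent hf.continuous x))).smul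
      (hf.continuous.sub continuous_const)).aestronglyMeasurable (ae_of_all _ fun y => ?_)
  set r := (f y - f z) / δ with hr
  have h1 : f y - f z = δ * r := by rw [hr]; field_simp
  have h3 : -f y / δ = -f z / δ - r := by rw [hr]; ring
  rw [smul_eq_mul, Real.norm_of_nonneg (mul_nonneg (Real.exp_pos _).le (sub_nonneg.2 (hz y))),
    gibbsExponent, Real.exp_add, mul_comm _ (Real.exp (-(_ / _))), mul_assoc, h3, h1, Real.exp_sub]
  refine mul_le_mul_of_nonneg_left ?_ (Real.exp_pos _).le
  have h2 := Real.add_one_le_exp r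
  rw [div_mul_eq_mul_div, div_le_iff₀ (Real.exp_pos _)]
  have h4 : r ≤ Real.exp r := by linarith
  calc _ = δ * Real.exp (-f z / δ) * r := by ring
    _ ≤ _ := by gcongr

end Gibbs

/-! ### Smoothness, convexity and coercivity of the envelope; the virial inequality. -/

section SoftMoreau

open Filter Topology

variable {d : ℕ} {f : EuclideanSpace ℝ (Fin d) → ℝ} {lam δ : ℝ}

theorem softMoreau_sub_le_of_exp_mul_le (hlam : 0 < lam) (hδ : 0 < δ)
    (hf : StandingAssumption f δ) {x y : EuclideanSpace ℝ (Fin d)} {a : ℝ}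
    (h : Real.exp a * gibbsPartition f lam δ x ≤ gibbsPartition f lam δ y) :
    softMoreau f lam δ y - softMoreau f lam δ x ≤ -δ * a := by
  have hx := gibbsPartition_pos hlam hδ hf x
  have := Real.log_le_log (by positivity) h
  rw [Real.log_mul (Real.exp_pos a).ne' hx.ne', Real.log_exp] at this
  rw [softMoreau_eq hlam hδ hf, softMoreau_eq hlam hδ hf]
  nlinarith

/-- Moving the centre from `x` to `y` changes the exponent by a function affine in the integration
variable, whose Gibbs mean involves only `zprox`. Convexity of `f` plays no role. -/
theorem softMoreau_le_quadratic (hlam : 0 < lam) (hδ : 0 < δ) (hf : StandingAssumption f δ)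
    (x y : EuclideanSpace ℝ (Fin d)) :
    softMoreau f lam δ y ≤ softMoreau f lam δ x +
      inner ℝ (lam⁻¹ • (x - zprox f lam δ x)) (y - x) + ‖y - x‖ ^ 2 / (2 * lam) := by
  have := isProbabilityMeasure_gibbsMeasure hlam hδ hf x
  have hsub := integrable_sub_gibbsMeasure hlam hδ hf x
  set u : EuclideanSpace ℝ (Fin d) → ℝ := fun w =>
    (lam * δ)⁻¹ * inner ℝ (w - x) (y - x) - ‖y - x‖ ^ 2 / (2 * (lam * δ)) with hu
  have huint : Integrable u (gibbsMeasure f lam δ x) :=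
    ((hsub.inner_const (y - x)).const_mul _).sub (integrable_const _)
  have hinner : ∫ w, inner ℝ (w - x) (y - x) ∂(gibbsMeasure f lam δ x) =
      inner ℝ (zprox f lam δ x - x) (y - x) :=
    (integral_congr_ae (ae_of_all _ fun w => real_inner_comm _ _)).trans
      ((integral_inner hsub _).trans
        (by rw [integral_sub_gibbsMeasure hlam hδ hf, real_inner_comm]))
  have hmean : ∫ w, u w ∂(gibbsMeasure f lam δ x) =
      (lam * δ)⁻¹ * inner ℝ (zprox f lam δ x - x) (y - x) - ‖y - x‖ ^ 2 / (2 * (lam * δ)) := by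
    rw [hu, integral_sub ((hsub.inner_const _).const_mul _) (integrable_const _),
      integral_const_mul, integral_const, probReal_univ, one_smul, hinner]
  have key := softMoreau_sub_le_of_exp_mul_le hlam hδ hf
    (exp_integral_tilted_mul_le (q := gibbsExponent f lam δ y) (u := u)
      (integrable_exp_gibbsExponent hlam hδ hf x) (integrable_exp_gibbsExponent hlam hδ hf y)
      huint fun w => by
        have e : ‖w - y‖ ^ 2 = ‖w - x‖ ^ 2 - 2 * inner ℝ (w - x) (y - x) + ‖y - x‖ ^ 2 := by
          rw [← sub_sub_sub_cancel_right w y x, norm_sub_sq_real]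
        rw [gibbsExponent, gibbsExponent, e, hu]
        apply le_of_eq
        field_simp
        ring)
  change _ ≤ -δ * ∫ w, u w ∂(gibbsMeasure f lam δ x) at key
  rw [hmean] at key
  have e : -δ * ((lam * δ)⁻¹ * inner ℝ (zprox f lam δ x - x) (y - x)
      - ‖y - x‖ ^ 2 / (2 * (lam * δ))) =
      inner ℝ (lam⁻¹ • (x - zprox f lam δ x)) (y - x) + ‖y - x‖ ^ 2 / (2 * lam) := by
    rw [real_inner_smul_left, ← neg_sub (zprox f lam δ x) x, inner_neg_left]
    field_simp
    ring
  linarith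

theorem gibbsExponent_add_le (hlam : 0 < lam) (hδ : 0 < δ) (hconv : ConvexOn ℝ Set.univ f)
    (x y a b : EuclideanSpace ℝ (Fin d)) :
    gibbsExponent f lam δ x a + gibbsExponent f lam δ y b ≤
      2 * gibbsExponent f lam δ ((2⁻¹ : ℝ) • (x + y)) ((2⁻¹ : ℝ) • (a + b)) := by
  have h1 := hconv.2 (Set.mem_univ a) (Set.mem_univ b) (show (0 : ℝ) ≤ 2⁻¹ by norm_num)
    (show (0 : ℝ) ≤ 2⁻¹ by norm_num) (by norm_num)
  rw [← smul_add, smul_eq_mul, smul_eq_mul] at h1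
  have h2 : ‖(2⁻¹ : ℝ) • (a + b) - (2⁻¹ : ℝ) • (x + y)‖ ^ 2 ≤
      2⁻¹ * (‖a - x‖ ^ 2 + ‖b - y‖ ^ 2) := by
    rw [← smul_sub, add_sub_add_comm, norm_smul, mul_pow]
    have := parallelogram_law_with_norm ℝ (a - x) (b - y)
    norm_num
    nlinarith [sq_nonneg ‖a - x - (b - y)‖]
  have h3 : ‖(2⁻¹ : ℝ) • (a + b) - (2⁻¹ : ℝ) • (x + y)‖ ^ 2 / (2 * (lam * δ)) ≤
      2⁻¹ * (‖a - x‖ ^ 2 + ‖b - y‖ ^ 2) / (2 * (lam * δ)) := by gcongr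
  have h4 : f ((2⁻¹ : ℝ) • (a + b)) / δ ≤ (2⁻¹ * f a + 2⁻¹ * f b) / δ := by gcongr
  simp only [gibbsExponent, neg_div]
  have e1 : 2⁻¹ * (‖a - x‖ ^ 2 + ‖b - y‖ ^ 2) / (2 * (lam * δ)) =
    2⁻¹ * (‖a - x‖ ^ 2 / (2 * (lam * δ)) + ‖b - y‖ ^ 2 / (2 * (lam * δ))) := by ring
  have e2 : (2⁻¹ * f a + 2⁻¹ * f b) / δ = 2⁻¹ * (f a / δ + f b / δ) := by ring
  linarith

theorem gibbsPartition_mul_le_sq (hlam : 0 < lam) (hδ : 0 < δ) (hf : StandingAssumption f δ)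
    (hconv : ConvexOn ℝ Set.univ f) (x y : EuclideanSpace ℝ (Fin d)) :
    gibbsPartition f lam δ x * gibbsPartition f lam δ y ≤
      gibbsPartition f lam δ ((2⁻¹ : ℝ) • (x + y)) ^ 2 := by
  have hmeas : ∀ z, Measurable fun w => ENNReal.ofReal (Real.exp (gibbsExponent f lam δ z w)) :=
    fun z => (Real.continuous_exp.comp
      (continuous_gibbsExponent hf.continuous z)).measurable.ennreal_ofReal
  have key := midpointPrekopaLeindler_euclideanSpace d _ _ _ (hmeas x) (hmeas y)
    (hmeas ((2⁻¹ : ℝ) • (x + y))) fun a b => by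
      rw [← ENNReal.ofReal_mul (Real.exp_pos _).le, ← ENNReal.ofReal_pow (Real.exp_pos _).le,
        ← Real.exp_add, ← Real.exp_nat_mul]
      exact ENNReal.ofReal_le_ofReal (Real.exp_le_exp.2
        (by exact_mod_cast gibbsExponent_add_le hlam hδ hconv x y a b))
  have hlint : ∀ z, ∫⁻ w, ENNReal.ofReal (Real.exp (gibbsExponent f lam δ z w)) =
      ENNReal.ofReal (gibbsPartition f lam δ z) := fun z =>
    (ofReal_integral_eq_lintegral_ofReal (integrable_exp_gibbsExponent hlam hδ hf z)
      (ae_of_all _ fun _ => (Real.exp_pos _).le)).symm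
  have hpos := fun z => (gibbsPartition_pos (lam := lam) hlam hδ hf z).le
  rw [hlint, hlint, hlint, ← ENNReal.ofReal_mul (hpos _), ← ENNReal.ofReal_pow (hpos _)] at key
  exact (ENNReal.ofReal_le_ofReal_iff (by positivity)).1 key

theorem softMoreau_midpoint_convex (hlam : 0 < lam) (hδ : 0 < δ) (hf : StandingAssumption f δ)
    (hconv : ConvexOn ℝ Set.univ f) (x y : EuclideanSpace ℝ (Fin d)) :
    2 * softMoreau f lam δ ((2⁻¹ : ℝ) • (x + y)) ≤
      softMoreau f lam δ x + softMoreau f lam δ y := by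
  have hpos := fun z => gibbsPartition_pos (lam := lam) hlam hδ hf z
  have := Real.log_le_log (mul_pos (hpos x) (hpos y)) (gibbsPartition_mul_le_sq hlam hδ hf hconv x y)
  rw [Real.log_mul (hpos x).ne' (hpos y).ne', Real.log_pow] at this
  push_cast at this
  rw [softMoreau_eq hlam hδ hf, softMoreau_eq hlam hδ hf, softMoreau_eq hlam hδ hf]
  nlinarith

theorem softMoreau_linear_le (hlam : 0 < lam) (hδ : 0 < δ) (hf : StandingAssumption f δ)
    (hconv : ConvexOn ℝ Set.univ f) (x y : EuclideanSpace ℝ (Fin d)) :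
    softMoreau f lam δ x + inner ℝ (lam⁻¹ • (x - zprox f lam δ x)) (y - x)
      ≤ softMoreau f lam δ y :=
  add_inner_le_of_midpoint_convex (g := fun x => lam⁻¹ • (x - zprox f lam δ x))
    (softMoreau_le_quadratic hlam hδ hf) (softMoreau_midpoint_convex hlam hδ hf hconv) x y

theorem hasGradientAt_softMoreau (hlam : 0 < lam) (hδ : 0 < δ) (hf : StandingAssumption f δ)
    (hconv : ConvexOn ℝ Set.univ f) (x : EuclideanSpace ℝ (Fin d)) :
    HasGradientAt (softMoreau f lam δ) (lam⁻¹ • (x - zprox f lam δ x)) x :=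
  hasGradientAt_of_quadratic_sandwich (g := fun x => lam⁻¹ • (x - zprox f lam δ x))
    (softMoreau_le_quadratic hlam hδ hf) (softMoreau_linear_le hlam hδ hf hconv) x

/-- Dominated convergence with majorant `exp (-f / δ)`. It makes the envelope coercive, hence its
minimum attained. -/
theorem tendsto_gibbsPartition_cocompact (hlam : 0 < lam) (hδ : 0 < δ)
    (hf : StandingAssumption f δ) :
    Tendsto (gibbsPartition f lam δ) (cocompact (EuclideanSpace ℝ (Fin d))) (𝓝 0) := by
  rw [← Metric.cobounded_eq_cocompact, ← comap_norm_atTop]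
  have hv : 0 < 2 * (lam * δ) := by positivity
  have h := tendsto_integral_filter_of_dominated_convergence
    (μ := (volume : Measure (EuclideanSpace ℝ (Fin d))))
    (l := comap (norm : EuclideanSpace ℝ (Fin d) → ℝ) atTop)
    (F := fun x y => Real.exp (gibbsExponent f lam δ x y)) (f := fun _ => (0 : ℝ))
    (fun y => Real.exp (-f y / δ))
    (Eventually.of_forall fun x =>
      (integrable_exp_gibbsExponent hlam hδ hf x).aestronglyMeasurable)
    (Eventually.of_forall fun x => ae_of_all _ fun y => by
      rw [Real.norm_of_nonneg (Real.exp_pos _).le]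
      exact exp_gibbsExponent_le hlam hδ x y)
    hf.integrable_exp
    (ae_of_all _ fun y => by
      refine Real.tendsto_exp_atBot.comp (tendsto_atBot_add_const_right _ _
        (tendsto_neg_atTop_atBot.comp (Tendsto.atTop_div_const hv
          ((tendsto_pow_atTop two_ne_zero).comp ?_))))
      refine tendsto_atTop_mono (fun x => ?_) (tendsto_atTop_add_const_right _ (-‖y‖) tendsto_comap)
      rw [norm_sub_rev, ← sub_eq_add_neg]
      exact norm_sub_norm_le x y)
  rw [integral_zero] at h
  exact h

theorem argminSet_softMoreau_nonempty (hlam : 0 < lam) (hδ : 0 < δ)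
    (hf : StandingAssumption f δ) (hconv : ConvexOn ℝ Set.univ f) :
    (argminSet (softMoreau f lam δ)).Nonempty := by
  have hcont : Continuous (softMoreau f lam δ) := continuous_iff_continuousAt.2 fun x =>
    (hasGradientAt_softMoreau hlam hδ hf hconv x).continuousAt
  have hlim : Tendsto (softMoreau f lam δ) (cocompact _) atTop := by
    rw [funext (softMoreau_eq hlam hδ hf)]
    refine tendsto_atTop_add_const_right _ _ (Tendsto.const_mul_atBot_of_neg (neg_lt_zero.2 hδ)
      (Real.tendsto_log_nhdsGT_zero.comp (tendsto_nhdsWithin_iff.2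
        ⟨tendsto_gibbsPartition_cocompact hlam hδ hf,
          Eventually.of_forall (gibbsPartition_pos hlam hδ hf)⟩)))
  exact hcont.exists_forall_le hlim

/-- The virial inequality for the Gibbs measure; for smooth `f` it is integration by parts against
`y - z` followed by convexity. -/
theorem integral_sub_add_integral_inner_le (hlam : 0 < lam) (hδ : 0 < δ)
    (hf : StandingAssumption f δ) (hconv : ConvexOn ℝ Set.univ f)
    (x z : EuclideanSpace ℝ (Fin d)) :
    ∫ y, f y ∂(gibbsMeasure f lam δ x) - f z +
      lam⁻¹ * ∫ y, inner ℝ (y - x) (y - z) ∂(gibbsMeasure f lam δ x) ≤ d * δ := by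
  have := isProbabilityMeasure_gibbsMeasure hlam hδ hf x
  have hfi := integrable_gibbsMeasure hlam hδ hf x
  have hin := integrable_inner_sub_gibbsMeasure hlam hδ hf x x z
  have hsq := integrable_norm_sub_sq_gibbsMeasure' hlam hδ hf x z
  have hp := integrable_exp_gibbsExponent (lam := lam) hlam hδ hf x
  set A := ∫ y, f y ∂(gibbsMeasure f lam δ x) - f z +
      lam⁻¹ * ∫ y, inner ℝ (y - x) (y - z) ∂(gibbsMeasure f lam δ x) with hA
  set B := (2 * lam)⁻¹ * ∫ y, ‖y - z‖ ^ 2 ∂(gibbsMeasure f lam δ x) with hB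
  have hZ := gibbsPartition_pos hlam hδ hf x
  -- The contraction `y ↦ (1 - s) • y + s • z` changes the integral by the Jacobian `(1 - s) ^ d`,
  -- while convexity bounds the change of the exponent below by `u`. The first-order term as `s → 0`
  -- is `A`.
  have key : ∀ s ∈ Set.Ioo (0 : ℝ) 1, (1 - s) ^ d * (A - s * B) ≤ d * δ := by
    rintro s ⟨hs0, hs1⟩
    have hs1' : 0 < 1 - s := by linarith
    set q : EuclideanSpace ℝ (Fin d) → ℝ :=
      fun y => gibbsExponent f lam δ x ((1 - s) • (y - z) + z) with hq
    have hqint : Integrable (fun y => Real.exp (q y)) :=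
      ((hp.comp_add_right z).comp_smul hs1'.ne').comp_sub_right z
    have hqval : (1 - s) ^ d * ∫ y, Real.exp (q y) = gibbsPartition f lam δ x := by
      rw [hq, integral_sub_right_eq_self (fun y =>
        Real.exp (gibbsExponent f lam δ x ((1 - s) • y + z))) z,
        Measure.integral_comp_smul volume (fun y => Real.exp (gibbsExponent f lam δ x (y + z))),
        integral_add_right_eq_self (fun y => Real.exp (gibbsExponent f lam δ x y)) z,
        finrank_euclideanSpace_fin, abs_of_pos (by positivity), smul_eq_mul,
        mul_inv_cancel_left₀ (by positivity), gibbsPartition]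
    set u : EuclideanSpace ℝ (Fin d) → ℝ := fun y => s / δ *
      (f y - f z + lam⁻¹ * inner ℝ (y - x) (y - z) - s * ((2 * lam)⁻¹ * ‖y - z‖ ^ 2)) with hu
    have i1 : Integrable (fun y => f y - f z) (gibbsMeasure f lam δ x) :=
      hfi.sub (integrable_const _)
    have i2 : Integrable (fun y => f y - f z + lam⁻¹ * inner ℝ (y - x) (y - z))
        (gibbsMeasure f lam δ x) := i1.add (hin.const_mul _)
    have i3 : Integrable (fun y => s * ((2 * lam)⁻¹ * ‖y - z‖ ^ 2)) (gibbsMeasure f lam δ x) :=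
      (hsq.const_mul _).const_mul _
    have huint : Integrable u (gibbsMeasure f lam δ x) := (i2.sub i3).const_mul _
    have hmean : ∫ y, u y ∂(gibbsMeasure f lam δ x) = s / δ * (A - s * B) := by
      rw [hu, integral_const_mul, integral_sub i2 i3, integral_add i1 (hin.const_mul _),
        integral_sub hfi (integrable_const _), integral_const_mul, integral_const_mul,
        integral_const_mul, integral_const, probReal_univ, one_smul]
    have hle : ∀ y, gibbsExponent f lam δ x y + u y ≤ q y := by
      intro y
      have h1 := hconv.2 (Set.mem_univ y) (Set.mem_univ z) hs1'.le hs0.le (by ring)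
      have e0 : (1 - s) • (y - z) + z = (1 - s) • y + s • z := by module
      have e1 : ‖(1 - s) • (y - z) + z - x‖ ^ 2 = ‖y - x‖ ^ 2
          - 2 * s * inner ℝ (y - x) (y - z) + s ^ 2 * ‖y - z‖ ^ 2 := by
        rw [show (1 - s) • (y - z) + z - x = (y - x) - s • (y - z) by module, norm_sub_sq_real,
          norm_smul, mul_pow, Real.norm_eq_abs, sq_abs, real_inner_smul_right]
        ring
      rw [smul_eq_mul, smul_eq_mul, ← e0] at h1
      have h2 : f ((1 - s) • (y - z) + z) / δ ≤ ((1 - s) * f y + s * f z) / δ := by gcongr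
      simp only [hq, hu, gibbsExponent, e1, neg_div]
      have e2 : (‖y - x‖ ^ 2 - 2 * s * inner ℝ (y - x) (y - z) + s ^ 2 * ‖y - z‖ ^ 2)
          / (2 * (lam * δ)) = ‖y - x‖ ^ 2 / (2 * (lam * δ)) -
          s / δ * (lam⁻¹ * inner ℝ (y - x) (y - z) - s * ((2 * lam)⁻¹ * ‖y - z‖ ^ 2)) := by
        field_simp
        ring
      have e3 : ((1 - s) * f y + s * f z) / δ = f y / δ - s / δ * (f y - f z) := by
        field_simp
        ring
      rw [e2]
      rw [e3] at h2
      linarith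
    have h1 := exp_integral_tilted_mul_le hp hqint huint hle
    change Real.exp (∫ y, u y ∂(gibbsMeasure f lam δ x)) * gibbsPartition f lam δ x ≤ _ at h1
    rw [hmean] at h1
    have h2 : (1 - s) ^ d * Real.exp (s / δ * (A - s * B)) ≤ 1 := by
      refine le_of_mul_le_mul_right ?_ hZ
      calc (1 - s) ^ d * Real.exp (s / δ * (A - s * B)) * gibbsPartition f lam δ x
          = (1 - s) ^ d * (Real.exp (s / δ * (A - s * B)) * gibbsPartition f lam δ x) := by ring
        _ ≤ (1 - s) ^ d * ∫ y, Real.exp (q y) := by gcongr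
        _ = 1 * gibbsPartition f lam δ x := by rw [hqval, one_mul]
    have h3 : (1 - s) ^ d * (s / δ * (A - s * B) + 1) ≤ 1 :=
      le_trans (by gcongr; exact Real.add_one_le_exp _) h2
    -- Bernoulli's inequality bounds the Jacobian defect `1 - (1 - s) ^ d` by `d * s`; this is where
    -- the dimension enters.
    have h4 := one_add_mul_le_pow (show (-2 : ℝ) ≤ -s by linarith) d
    rw [← sub_eq_add_neg] at h4
    have h5 : s / δ * ((1 - s) ^ d * (A - s * B)) ≤ s / δ * (d * δ) := by
      have : s / δ * (d * δ) = d * s := by field_simp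
      rw [this]
      linarith
    exact le_of_mul_le_mul_left h5 (by positivity)
  have hcont : Continuous fun s : ℝ => (1 - s) ^ d * (A - s * B) := by fun_prop
  have hlim : Tendsto (fun s : ℝ => (1 - s) ^ d * (A - s * B)) (𝓝[>] 0) (𝓝 A) := by
    simpa using (hcont.tendsto 0).mono_left nhdsWithin_le_nhds
  exact le_of_tendsto hlim (Filter.mem_of_superset (Ioo_mem_nhdsGT one_pos) key)

theorem apply_zprox_le_integral (hlam : 0 < lam) (hδ : 0 < δ)
    (hf : StandingAssumption f δ) (hconv : ConvexOn ℝ Set.univ f)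
    (x : EuclideanSpace ℝ (Fin d)) :
    f (zprox f lam δ x) ≤ ∫ y, f y ∂(gibbsMeasure f lam δ x) := by
  have := isProbabilityMeasure_gibbsMeasure hlam hδ hf x
  rw [zprox_eq hlam hδ]
  exact hconv.map_integral_le hf.continuous.continuousOn isClosed_univ (by simp)
    (integrable_id_gibbsMeasure hlam hδ hf x) (integrable_gibbsMeasure hlam hδ hf x)

theorem integral_inner_sub_gibbsMeasure (hlam : 0 < lam) (hδ : 0 < δ)
    (hf : StandingAssumption f δ) (x z : EuclideanSpace ℝ (Fin d)) :
    ∫ y, inner ℝ (y - x) (y - z) ∂(gibbsMeasure f lam δ x) =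
      ∫ y, ‖y - zprox f lam δ x‖ ^ 2 ∂(gibbsMeasure f lam δ x) +
        inner ℝ (zprox f lam δ x - x) (zprox f lam δ x - z) := by
  have := isProbabilityMeasure_gibbsMeasure hlam hδ hf x
  set p := zprox f lam δ x with hp
  have h0 : Integrable (fun y => y - p) (gibbsMeasure f lam δ x) :=
    (integrable_id_gibbsMeasure hlam hδ hf x).sub (integrable_const p)
  have h1 := integrable_norm_sub_sq_gibbsMeasure' hlam hδ hf x p
  have h2 : Integrable (fun y => inner ℝ ((p - z) + (p - x)) (y - p)) (gibbsMeasure f lam δ x) :=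
    h0.const_inner _
  have h3 : ∫ y, inner ℝ ((p - z) + (p - x)) (y - p) ∂(gibbsMeasure f lam δ x) = 0 := by
    rw [integral_inner h0, integral_sub_gibbsMeasure hlam hδ hf, ← hp, sub_self, inner_zero_right]
  calc ∫ y, inner ℝ (y - x) (y - z) ∂(gibbsMeasure f lam δ x)
      = ∫ y, (‖y - p‖ ^ 2 + inner ℝ ((p - z) + (p - x)) (y - p) + inner ℝ (p - x) (p - z))
          ∂(gibbsMeasure f lam δ x) := by
        refine integral_congr_ae (ae_of_all _ fun y => ?_)
        dsimp only
        rw [← sub_add_sub_cancel y p x, ← sub_add_sub_cancel y p z, inner_add_left,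
          inner_add_right, inner_add_right, inner_add_left, real_inner_self_eq_norm_sq,
          real_inner_comm (p - z) (y - p)]
        ring
    _ = _ := by
        have h4 : Integrable (fun y => ‖y - p‖ ^ 2 + inner ℝ ((p - z) + (p - x)) (y - p))
          (gibbsMeasure f lam δ x) := h1.add h2
        rw [integral_add h4 (integrable_const _), integral_add h1 h2, h3, integral_const,
          probReal_univ, one_smul, add_zero]

theorem gradient_mem_epsSubdifferential (hlam : 0 < lam) (hδ : 0 < δ)
    (hf : StandingAssumption f δ) (hconv : ConvexOn ℝ Set.univ f)
    (x : EuclideanSpace ℝ (Fin d)) :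
    lam⁻¹ • (x - zprox f lam δ x) ∈ epsSubdifferential (d * δ) f (zprox f lam δ x) := by
  intro z
  have h1 := integral_sub_add_integral_inner_le hlam hδ hf hconv x z
  have h2 := apply_zprox_le_integral hlam hδ hf hconv x
  rw [integral_inner_sub_gibbsMeasure hlam hδ hf, mul_add] at h1
  have h3 : 0 ≤ lam⁻¹ * ∫ y, ‖y - zprox f lam δ x‖ ^ 2 ∂(gibbsMeasure f lam δ x) :=
    mul_nonneg (by positivity) (integral_nonneg fun _ => by positivity)
  rw [real_inner_smul_left, ← neg_sub (zprox f lam δ x) x, ← neg_sub (zprox f lam δ x) z,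
    inner_neg_neg]
  linarith

/-- In the virial inequality with `z` the mean, Jensen makes the gap in `f` nonnegative and only the
variance term remains. -/
theorem integral_norm_sub_zprox_sq_le (hlam : 0 < lam) (hδ : 0 < δ)
    (hf : StandingAssumption f δ) (hconv : ConvexOn ℝ Set.univ f)
    (x : EuclideanSpace ℝ (Fin d)) :
    ∫ y, ‖y - zprox f lam δ x‖ ^ 2 ∂(gibbsMeasure f lam δ x) ≤ d * lam * δ := by
  have h1 := integral_sub_add_integral_inner_le hlam hδ hf hconv x (zprox f lam δ x)
  have h2 := apply_zprox_le_integral hlam hδ hf hconv x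
  rw [integral_inner_sub_gibbsMeasure hlam hδ hf, sub_self, inner_zero_right, add_zero] at h1
  have h3 : lam⁻¹ * ∫ y, ‖y - zprox f lam δ x‖ ^ 2 ∂(gibbsMeasure f lam δ x) ≤ d * δ := by
    linarith
  rw [inv_mul_le_iff₀ hlam] at h3
  linarith

theorem integral_norm_sub_le (hlam : 0 < lam) (hδ : 0 < δ)
    (hf : StandingAssumption f δ) (hconv : ConvexOn ℝ Set.univ f)
    (x : EuclideanSpace ℝ (Fin d)) :
    ∫ y, ‖y - x‖ ∂(gibbsMeasure f lam δ x) ≤ ‖x - zprox f lam δ x‖ + √(d * lam * δ) := by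
  have := isProbabilityMeasure_gibbsMeasure hlam hδ hf x
  set p := zprox f lam δ x with hp
  have h0 : Integrable (fun y => ‖y - p‖) (gibbsMeasure f lam δ x) :=
    ((integrable_id_gibbsMeasure hlam hδ hf x).sub (integrable_const p)).norm
  have hsq := integrable_norm_sub_sq_gibbsMeasure' hlam hδ hf x p
  have h1 : (∫ y, ‖y - p‖ ∂(gibbsMeasure f lam δ x)) ^ 2 ≤
      ∫ y, ‖y - p‖ ^ 2 ∂(gibbsMeasure f lam δ x) :=
    (even_two.convexOn_pow (𝕜 := ℝ)).map_integral_le (continuous_pow 2).continuousOn isClosed_univ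
      (by simp) h0 hsq
  have h2 : ∫ y, ‖y - p‖ ∂(gibbsMeasure f lam δ x) ≤ √(d * lam * δ) :=
    Real.le_sqrt_of_sq_le (h1.trans (integral_norm_sub_zprox_sq_le hlam hδ hf hconv x))
  calc ∫ y, ‖y - x‖ ∂(gibbsMeasure f lam δ x)
      ≤ ∫ y, (‖x - p‖ + ‖y - p‖) ∂(gibbsMeasure f lam δ x) := by
        refine integral_mono (integrable_sub_gibbsMeasure hlam hδ hf x).norm
          ((integrable_const _).add h0) fun y => ?_
        dsimp only
        rw [norm_sub_rev x p, add_comm]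
        exact norm_sub_le_norm_sub_add_norm_sub y p x
    _ = ‖x - p‖ + ∫ y, ‖y - p‖ ∂(gibbsMeasure f lam δ x) := by
        rw [integral_add (integrable_const _) h0, integral_const, probReal_univ, one_smul]
    _ ≤ _ := by gcongr

end SoftMoreau

/-! ### Comparison of the two gradients for smooth `f`. -/

section Smooth

open Filter Topology

theorem ConvexOn.add_inner_gradient_le {E : Type*} [NormedAddCommGroup E] [InnerProductSpace ℝ E]
    [CompleteSpace E] {f : E → ℝ} (hconv : ConvexOn ℝ Set.univ f) {x : E}
    (hx : DifferentiableAt ℝ f x) (y : E) :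
    f x + inner ℝ (gradient f x) (y - x) ≤ f y := by
  have hline : ConvexOn ℝ Set.univ fun t : ℝ => f (AffineMap.lineMap x y t) := by
    exact hconv.comp_affineMap (AffineMap.lineMap x y : ℝ →ᵃ[ℝ] E)
  have hf0 : HasFDerivAt f (InnerProductSpace.toDual ℝ E (gradient f x))
      (AffineMap.lineMap x y (0 : ℝ)) := by
    simpa using hx.hasGradientAt.hasFDerivAt
  have hderiv : HasDerivAt (fun t : ℝ => f (AffineMap.lineMap x y t))
      (inner ℝ (gradient f x) (y - x)) 0 := by
    exact hf0.comp_hasDerivAt (0 : ℝ) AffineMap.hasDerivAt_lineMap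
  have := hline.le_slope_of_hasDerivAt (Set.mem_univ 0) (Set.mem_univ 1) one_pos hderiv
  simp only [slope_def_field, AffineMap.lineMap_apply_one, AffineMap.lineMap_apply_zero, sub_zero,
    div_one] at this
  linarith

variable {d : ℕ} {f : EuclideanSpace ℝ (Fin d) → ℝ} {lam δ : ℝ}

theorem LSmooth.nonneg {L : ℝ} [Nontrivial (EuclideanSpace ℝ (Fin d))] (h : LSmooth L f) :
    0 ≤ L := by
  obtain ⟨x, y, hxy⟩ := exists_pair_ne (EuclideanSpace ℝ (Fin d))
  exact nonneg_of_mul_nonneg_left ((norm_nonneg _).trans (h.2 x y))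
    (norm_pos_iff.2 (sub_ne_zero.2 hxy))

/-- Translating the integration variable together with the centre leaves the Gaussian term
unchanged, so only `f (y + s • v) - f y` matters; convexity and the Lipschitz gradient bound it. -/
theorem softMoreau_add_smul_sub_le (hlam : 0 < lam) (hδ : 0 < δ)
    (hf : StandingAssumption f δ) (hconv : ConvexOn ℝ Set.univ f) {L : ℝ} (hL0 : 0 ≤ L)
    (hL : LSmooth L f) (x v : EuclideanSpace ℝ (Fin d)) {s : ℝ} (hs : 0 < s) :
    softMoreau f lam δ (x + s • v) - softMoreau f lam δ x ≤
      s * (inner ℝ (gradient f x) v +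
        L * (∫ y, ‖y - x‖ ∂(gibbsMeasure f lam δ x) + s * ‖v‖) * ‖v‖) := by
  have := isProbabilityMeasure_gibbsMeasure hlam hδ hf x
  have hnorm := (integrable_sub_gibbsMeasure hlam hδ hf x).norm
  have hdiff : Differentiable ℝ f := hL.1.differentiable one_ne_zero
  set u : EuclideanSpace ℝ (Fin d) → ℝ := fun y =>
    -(s / δ) * (inner ℝ (gradient f x) v + L * (‖y - x‖ + s * ‖v‖) * ‖v‖) with hu
  have i1 : Integrable (fun y => L * (‖y - x‖ + s * ‖v‖) * ‖v‖) (gibbsMeasure f lam δ x) :=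
    ((hnorm.add (integrable_const _)).const_mul L).mul_const _
  have huint : Integrable u (gibbsMeasure f lam δ x) :=
    ((integrable_const _).add i1).const_mul _
  have hmean : ∫ y, u y ∂(gibbsMeasure f lam δ x) = -(s / δ) * (inner ℝ (gradient f x) v +
      L * (∫ y, ‖y - x‖ ∂(gibbsMeasure f lam δ x) + s * ‖v‖) * ‖v‖) := by
    rw [hu, integral_const_mul, integral_add (integrable_const _) i1, integral_mul_const,
      integral_const_mul, integral_add hnorm (integrable_const _), integral_const, integral_const,
      probReal_univ, one_smul, one_smul]
  have hq := integrable_exp_gibbsExponent (lam := lam) hlam hδ hf (x + s • v)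
  have hshift : ∫ y, Real.exp (gibbsExponent f lam δ (x + s • v) (y + s • v)) =
      gibbsPartition f lam δ (x + s • v) :=
    integral_add_right_eq_self (fun y => Real.exp (gibbsExponent f lam δ (x + s • v) y)) (s • v)
  have key := exp_integral_tilted_mul_le (integrable_exp_gibbsExponent hlam hδ hf x)
    (hq.comp_add_right (s • v)) huint fun y => by
      have h1 := hconv.add_inner_gradient_le (hdiff (y + s • v)) y
      rw [sub_add_cancel_left, inner_neg_right, real_inner_smul_right] at h1
      have h2 : inner ℝ (gradient f (y + s • v)) v ≤
          inner ℝ (gradient f x) v + L * (‖y - x‖ + s * ‖v‖) * ‖v‖ := by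
        rw [← sub_le_iff_le_add', ← inner_sub_left]
        refine (real_inner_le_norm _ _).trans ?_
        gcongr
        refine (hL.2 _ _).trans ?_
        gcongr
        rw [add_sub_right_comm]
        refine (norm_add_le _ _).trans_eq ?_
        rw [norm_smul, Real.norm_of_nonneg hs.le]
      have h3 : f (y + s • v) ≤ f y +
          s * (inner ℝ (gradient f x) v + L * (‖y - x‖ + s * ‖v‖) * ‖v‖) := by
        have := mul_le_mul_of_nonneg_left h2 hs.le
        linarith
      have h4 := div_le_div_of_nonneg_right h3 hδ.le
      simp only [hu, gibbsExponent, add_sub_add_right_eq_sub, neg_div]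
      rw [add_div, mul_div_right_comm] at h4
      linarith
  rw [hshift] at key
  have := softMoreau_sub_le_of_exp_mul_le hlam hδ hf key
  change _ ≤ -δ * ∫ y, u y ∂(gibbsMeasure f lam δ x) at this
  rw [hmean] at this
  refine this.trans_eq ?_
  field_simp

theorem norm_sub_gradient_le (hlam : 0 < lam) (hδ : 0 < δ)
    (hf : StandingAssumption f δ) (hconv : ConvexOn ℝ Set.univ f) {L : ℝ} (hL0 : 0 ≤ L)
    (hL : LSmooth L f) (x : EuclideanSpace ℝ (Fin d)) :
    ‖lam⁻¹ • (x - zprox f lam δ x) - gradient f x‖ ≤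
      L * ∫ y, ‖y - x‖ ∂(gibbsMeasure f lam δ x) := by
  have hlin := softMoreau_linear_le hlam hδ hf hconv x
  have hsm := softMoreau_add_smul_sub_le hlam hδ hf hconv hL0 hL x
  have hM0 : 0 ≤ ∫ y, ‖y - x‖ ∂(gibbsMeasure f lam δ x) := integral_nonneg fun _ => norm_nonneg _
  generalize lam⁻¹ • (x - zprox f lam δ x) = g at hlin ⊢
  generalize ∫ y, ‖y - x‖ ∂(gibbsMeasure f lam δ x) = M at hsm hM0 ⊢
  generalize gradient f x = r at hsm ⊢
  -- Testing in the direction `g - r` turns the bound on directional derivatives into one on the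
  -- norm of the difference.
  obtain ⟨v, hv⟩ : ∃ v, v = g - r := ⟨_, rfl⟩
  rw [← hv]
  have hbound : ∀ s > 0, inner ℝ g v ≤ inner ℝ r v + L * (M + s * ‖v‖) * ‖v‖ := by
    intro s hs
    have h1 := hlin (x + s • v)
    have h2 := hsm v hs
    rw [add_sub_cancel_left, real_inner_smul_right] at h1
    refine le_of_mul_le_mul_left ?_ hs
    linarith
  have hcont : Continuous fun s : ℝ => inner ℝ r v + L * (M + s * ‖v‖) * ‖v‖ := by fun_prop
  have hlim : Tendsto (fun s : ℝ => inner ℝ r v + L * (M + s * ‖v‖) * ‖v‖) (𝓝[>] 0)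
      (𝓝 (inner ℝ r v + L * M * ‖v‖)) := by
    simpa using (hcont.tendsto 0).mono_left nhdsWithin_le_nhds
  have h1 := ge_of_tendsto hlim (Filter.mem_of_superset self_mem_nhdsWithin hbound)
  have h2 : ‖v‖ ^ 2 = inner ℝ g v - inner ℝ r v := by
    rw [← inner_sub_left, ← hv, real_inner_self_eq_norm_sq]
  rcases (norm_nonneg v).eq_or_lt with h0 | h0
  · rw [← h0]
    exact mul_nonneg hL0 hM0
  · refine le_of_mul_le_mul_right ?_ h0
    rw [← sq]
    linarith

theorem norm_gradient_le_of_lSmooth (hlam : 0 < lam) (hδ : 0 < δ)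
    (hf : StandingAssumption f δ) (hconv : ConvexOn ℝ Set.univ f) {L : ℝ}
    (hL : LSmooth L f) (x : EuclideanSpace ℝ (Fin d)) :
    ‖gradient f x‖ ≤ (1 + lam * L) * ‖lam⁻¹ • (x - zprox f lam δ x)‖ + L * √(d * lam * δ) := by
  -- In dimension zero `LSmooth L f` does not force `0 ≤ L`, but both gradients vanish.
  rcases Nat.eq_zero_or_pos d with rfl | hd
  · rw [Subsingleton.elim (gradient f x) 0, Subsingleton.elim (lam⁻¹ • (x - zprox f lam δ x)) 0]
    simp
  have : Nonempty (Fin d) := ⟨⟨0, hd⟩⟩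
  have hL0 : 0 ≤ L := hL.nonneg
  have h3 := norm_sub_gradient_le hlam hδ hf hconv hL0 hL x
  have h4 := integral_norm_sub_le hlam hδ hf hconv x
  have h5 : ‖x - zprox f lam δ x‖ = lam * ‖lam⁻¹ • (x - zprox f lam δ x)‖ := by
    rw [norm_smul, norm_inv, Real.norm_of_nonneg hlam.le, mul_inv_cancel_left₀ hlam.ne']
  rw [h5] at h4
  have h6 := norm_sub_norm_le (gradient f x) (lam⁻¹ • (x - zprox f lam δ x))
  rw [norm_sub_rev] at h6
  have h7 := mul_le_mul_of_nonneg_left h4 hL0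
  linarith

end Smooth

/-! ### From subgradients to suboptimality gaps, and the main theorem. -/

theorem isClosed_argminSet {d : ℕ} {f : EuclideanSpace ℝ (Fin d) → ℝ} (hf : Continuous f) :
    IsClosed (argminSet f) := by
  simp only [argminSet, Set.ofPred_forall]
  exact isClosed_iInter fun y => isClosed_le hf continuous_const

theorem iInf_eq_of_mem_argminSet {d : ℕ} {f : EuclideanSpace ℝ (Fin d) → ℝ}
    {z : EuclideanSpace ℝ (Fin d)} (hz : z ∈ argminSet f) : ⨅ y, f y = f z :=
  le_antisymm (ciInf_le ⟨f z, by rintro _ ⟨y, rfl⟩; exact hz y⟩ z) (le_ciInf hz)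

/-- An approximate subgradient at `x` bounds the suboptimality gap at `x`. -/
theorem sub_iInf_le_of_mem_epsSubdifferential {d : ℕ} {f : EuclideanSpace ℝ (Fin d) → ℝ}
    (hf : Continuous f) (hne : (argminSet f).Nonempty) {ε : ℝ} {x g : EuclideanSpace ℝ (Fin d)}
    (hg : g ∈ epsSubdifferential ε f x) :
    f x - ⨅ y, f y ≤ ‖g‖ * Metric.infDist x (argminSet f) + ε := by
  obtain ⟨z, hz, hdist⟩ := (isClosed_argminSet hf).exists_infDist_eq_dist hne x
  have h1 := hg z
  have h2 := real_inner_le_norm g (x - z)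
  rw [← neg_sub x z, inner_neg_right] at h1
  rw [iInf_eq_of_mem_argminSet hz, hdist, dist_eq_norm]
  linarith

theorem theorem6 {d : ℕ} (f : EuclideanSpace ℝ (Fin d) → ℝ) (lam δ : ℝ)
    (hlam : 0 < lam) (hδ : 0 < δ)
    (hf : StandingAssumption f δ) (hconv : ConvexOn ℝ Set.univ f) :
    -- the soft Moreau envelope is differentiable and attains its minimum
    Differentiable ℝ (softMoreau f lam δ) ∧
    (argminSet (softMoreau f lam δ)).Nonempty ∧
    -- its gradient is an approximate subgradient of `f`
    (∀ x, gradient (softMoreau f lam δ) x ∈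
      epsSubdifferential (d * δ) f (zprox f lam δ x)) ∧
    ∀ x : ℕ → EuclideanSpace ℝ (Fin d), IsZoppaSequence f lam δ x →
      -- (i) the nonsmooth bound, for every iterate of index at least one
      (∀ k, f (x (k + 1)) - ⨅ y, f y ≤
        ‖gradient (softMoreau f lam δ) (x k)‖ * Metric.infDist (x (k + 1)) (argminSet f)
          + d * δ) ∧
      -- (ii) the smooth bounds
      (∀ L : ℝ, LSmooth L f → ∀ k,
        ‖gradient f (x k)‖ ≤
          (1 + lam * L) * ‖gradient (softMoreau f lam δ) (x k)‖ + L * √(d * lam * δ) ∧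
        f (x k) - ⨅ y, f y ≤
          ((1 + lam * L) * ‖gradient (softMoreau f lam δ) (x k)‖ + L * √(d * lam * δ))
            * Metric.infDist (x k) (argminSet f)) ∧
      -- the rate for the gradient norms in the previous bounds
      (∀ k : ℕ, ‖gradient (softMoreau f lam δ) (x k)‖ ≤
        2 * Metric.infDist (x 0) (argminSet (softMoreau f lam δ)) / (lam * (k + 1))) := by
  have hgrad := fun x => (hasGradientAt_softMoreau hlam hδ hf hconv x).gradient
  have hdiff : Differentiable ℝ (softMoreau f lam δ) := fun x =>
    (hasGradientAt_softMoreau hlam hδ hf hconv x).differentiableAt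
  have hne := argminSet_softMoreau_nonempty (lam := lam) hlam hδ hf hconv
  have hnef : (argminSet f).Nonempty := hf.exists_minimizer
  refine ⟨hdiff, hne, fun x => ?_, fun x hx => ⟨fun k => ?_, fun L hL k => ?_, fun k => ?_⟩⟩
  · rw [hgrad]
    exact gradient_mem_epsSubdifferential hlam hδ hf hconv x
  · rw [hgrad, hx k]
    exact sub_iInf_le_of_mem_epsSubdifferential hf.continuous hnef
      (gradient_mem_epsSubdifferential hlam hδ hf hconv (x k))
  · have h1 := norm_gradient_le_of_lSmooth hlam hδ hf hconv hL (x k)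
    rw [hgrad]
    -- An exact gradient is an approximate subgradient with `ε = 0`, so the gap lemma behind (i)
    -- also yields the function bound in (ii).
    have h2 : gradient f (x k) ∈ epsSubdifferential 0 f (x k) := fun y => by
      simpa using hconv.add_inner_gradient_le (hL.1.differentiable one_ne_zero (x k)) y
    have h3 := sub_iInf_le_of_mem_epsSubdifferential hf.continuous hnef h2
    rw [add_zero] at h3
    exact ⟨h1, h3.trans (mul_le_mul_of_nonneg_right h1 Metric.infDist_nonneg)⟩
  · obtain ⟨z, hz, hdist⟩ :=
      (isClosed_argminSet hdiff.continuous).exists_infDist_eq_dist hne (x 0)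
    rw [hgrad, hdist, dist_eq_norm]
    refine norm_gradient_descent_le (g := fun x => lam⁻¹ • (x - zprox f lam δ x)) hlam
      (softMoreau_le_quadratic hlam hδ hf) (softMoreau_linear_le hlam hδ hf hconv) hz
      (fun j => ?_) k
    -- The zeroth-order prox is exactly a gradient step of length `lam` on the envelope.
    rw [hx j, smul_inv_smul₀ hlam.ne', sub_sub_cancel]
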